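/- **Setting.** For a diffeological space $X$, let $\Omega^1(X)$ be the space of differential $1$-forms with its functional diffeology, $\Omega^1_x(X)$ the forms vanishing at $x$ (i.e. $\omega(p)(0)=0$ for all plots $p$ with $p(0)=x$), $\Lambda^1_x(X)=\Omega^1(X)/\Omega^1_x(X)$, and $\Lambda^1(X)=\bigsqcup_x\Lambda^1_x(X)$ with the quotient diffeology of $X\times\Omega^1(X)$. A diffeological vector pseudo-bundle $V\to X$ is a diffeological space over $X$ with vector space fibres $V_x$, smooth fibrewise operations and smooth zero section (no local triviality). A connection on $V$ is a smooth linear operator $\nabla:C^\infty(X,V)\to C^\infty(X,\Lambda^1(X)\otimes V)$ with $\nabla(hs)=dh\otimes s+h\nabla s$. A pseudo-metric on $V$ (with finite-dimensional fibres) is a smooth section $g$ of $V^*\otimes V^*$ such that each $g(x)$ is symmetric positive semidefinite with kernel of dimension $\dim V_x-\dim V_x^*$, where $V_x^*$ is the space of smooth linear functionals. The operator $\nabla$ is compatible with $g$ if $d(g(s,t))=g(\nabla s,t)+g(s,\nabla t)$ for all smooth sections $s,t$, where $g(\omega\otimes s,t)=g(s,\omega\otimes t)=g(s,t)\,\omega$.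 **Gluing.** Let $V_1\to X_1$, $V_2\to X_2$ be diffeological vector pseudo-bundles with finite-dimensional fibres, let $Y\subseteq X_1$, let $f:Y\to X_2$ be a diffeomorphism onto its image, and let $\tilde f:V_1|_Y\to V_2|_{f(Y)}$ be a fibrewise linear diffeomorphism over $f$. Let $X_1\cup_fX_2$ and $V_\cup=V_1\cup_{\tilde f}V_2$ be the quotients of the disjoint unions by $y\sim f(y)$ and $v\sim\tilde f(v)$. Every smooth section of $V_\cup$ is $s=s_1\cup s_2$ for a unique compatible pair of smooth sections, i.e. one with $\tilde f(s_1(y))=s_2(f(y))$ on $Y$. Let $i:Y\to X_1$, $j:f(Y)\to X_2$ be the inclusions, $\mathcal D_1^\Omega$, $\mathcal D_2^\Omega$ the pushforwards to $\Omega^1(Y)$ of the diffeologies of $\Omega^1(X_1)$, $\Omega^1(X_2)$ along $i^*$, $f^*j^*$, and let $\tilde\rho_1,\tilde\rho_2$ be the restrictions of values of forms from $X_1\cup_fX_2$ to $X_1$, $X_2$ (where the base point comes from $X_1$, respectively $X_2$). Pseudo-metrics $g_1,g_2$ are compatible if $g_1(y)(v,w)=g_2(f(y))(\tilde fv,\tilde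 fw)$ for $y\in Y$; the induced pseudo-metric $\tilde g$ on $V_\cup$ is $g_1$ over $X_1\setminus Y$ and $g_2$ over $X_2$. Connections $\nabla^1,\nabla^2$ are compatible if $(i^*\otimes\tilde f)(\nabla^1s_1(y))=(f^*j^*\otimes\mathrm{Id})(\nabla^2s_2(f(y)))$ in $\Lambda^1_y(Y)\otimes (V_2)_{f(y)}$ for all compatible $s_1,s_2$ and $y\in Y$. The induced operator is given, for $s=s_1\cup s_2$, by $$(\nabla^\cup s)(x)=\begin{cases}(\tilde\rho_1\otimes\mathrm{Id})^{-1}(\nabla^1s_1(x)), & x\in X_1\setminus Y,\\ (\tilde\rho_2\otimes\mathrm{Id})^{-1}(\nabla^2s_2(x)), & x\in X_2\setminus f(Y),\\ ((\tilde\rho_1\oplus\tilde\rho_2)\otimes\mathrm{Id})^{-1}\big((\mathrm{Incl}_1\otimes\tilde f)(\nabla^1s_1(y))+(\mathrm{Incl}_2\otimes\mathrm{Id})(\nabla^2s_2(f(y)))\big), & x=f(y),\end{cases}$$ where $\mathrm{Incl}_1,\mathrm{Incl}_2$ are the inclusions of $\Lambda^1_y(X_1)$, $\Lambda^1_{f(y)}(X_2)$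 into their direct sum. **Theorem.** Suppose that $\mathcal D_1^\Omega=\mathcal D_2^\Omega$, that $g_1,g_2$ are compatible pseudo-metrics on $V_1,V_2$, that $\nabla^1,\nabla^2$ are compatible connections on $V_1,V_2$, and that $\nabla^i$ is compatible with $g_i$ for $i=1,2$. Suppose also that the induced operator is well-defined over the domain of gluing, i.e. that for all $s$ and all $y\in Y$ the element in the third line lies in the range of $(\tilde\rho_1\oplus\tilde\rho_2)\otimes\mathrm{Id}$. Then the operator $\nabla^\cup$ is defined everywhere by the three-line formula (the elements in the first two lines lie in the ranges of $\tilde\rho_1\otimes\mathrm{Id}$ and $\tilde\rho_2\otimes\mathrm{Id}$), and it is compatible with $\tilde g$: for all smooth sections $s,t$ of $V_\cup$ the function $\tilde g(s,t)$ is smooth and $d(\tilde g(s,t))=\tilde g(\nabla^\cup s,t)+\tilde g(s,\nabla^\cup t)$. -/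

import Mathlib

open Diffeology
open scoped ContDiff TensorProduct

universe u v w u₁ u₂

noncomputable section

namespace DiffGluing

/-- The parameter spaces of plots. -/
abbrev E (n : ℕ) : Type := EuclideanSpace ℝ (Fin n)

/-! ### Constructions of diffeologies -/

section Constructions

variable {X Z : Type*}

/-- The diffeology whose plots are the maps that are locally members of a family `S` of maps
which contains the constants and is stable under smooth reparametrization. -/
@[reducible] def ofLocal (S : ∀ n, Set (E n → X))
    (hc : ∀ n x, (fun _ : E n => x) ∈ S n)
    (_hr : ∀ n m (p : E m → X) (f : E n → E m), p ∈ S m → ContDiff ℝ ∞ f → p ∘ f ∈ S n) :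
    DiffeologicalSpace X where
  plots n := {p | ∀ x : E n, ∃ u : Set (E n), IsOpen u ∧ x ∈ u ∧
    ∀ m (f : E m → E n), (∀ y, f y ∈ u) → ContDiff ℝ ∞ f → p ∘ f ∈ S m}
  constant_plots {n} x := fun _ => ⟨Set.univ, isOpen_univ, trivial, fun m _ _ _ => hc m x⟩
  plot_reparam {n m p f} hp hf := fun x => by
    obtain ⟨u, hu, hx, h⟩ := hp (f x)
    exact ⟨f ⁻¹' u, hu.preimage hf.continuous, hx, fun k g hg hgs =>
      h k (f ∘ g) hg (hf.comp hgs)⟩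
  locality {n p} hp := fun x => by
    obtain ⟨u, hu, hx, h⟩ := hp x
    obtain ⟨ε, hε, hb⟩ := Metric.isOpen_iff.mp hu x hx
    have hmem : ∀ y, OpenPartialHomeomorph.univBall x ε y ∈ Metric.ball x ε := fun y => by
      have := (OpenPartialHomeomorph.univBall x ε).map_source (x := y) (by simp)
      rwa [OpenPartialHomeomorph.univBall_target x hε] at this
    have h1 := h (f := OpenPartialHomeomorph.univBall x ε) (fun y => hb (hmem y))
      OpenPartialHomeomorph.contDiff_univBall
    obtain ⟨w, hw, h0, hS⟩ := h1 0
    refine ⟨Metric.ball x ε ∩ (OpenPartialHomeomorph.univBall x ε).symm ⁻¹' w, ?_, ?_, ?_⟩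
    · have := (OpenPartialHomeomorph.univBall x ε).symm.isOpen_inter_preimage hw
      rwa [OpenPartialHomeomorph.symm_source, OpenPartialHomeomorph.univBall_target x hε] at this
    · refine ⟨Metric.mem_ball_self hε, ?_⟩
      rw [Set.mem_preimage, OpenPartialHomeomorph.univBall_symm_apply_center]
      exact h0
    · intro m f hf hfs
      have h2 := hS m ((OpenPartialHomeomorph.univBall x ε).symm ∘ f) (fun y => (hf y).2)
        (contDiffOn_univ.mp ((OpenPartialHomeomorph.contDiffOn_univBall_symm (c := x)
          (r := ε)).comp hfs.contDiffOn (fun y _ => (hf y).1)))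
      have h3 : (p ∘ OpenPartialHomeomorph.univBall x ε) ∘
          ((OpenPartialHomeomorph.univBall x ε).symm ∘ f) = p ∘ f := by
        funext y
        simp only [Function.comp_apply]
        rw [(OpenPartialHomeomorph.univBall x ε).right_inv]
        rw [OpenPartialHomeomorph.univBall_target x hε]
        exact (hf y).1
      rwa [h3] at h2

/-- The pullback diffeology: the coarsest diffeology on `X` that makes `f : X → Z` smooth. -/
@[reducible] def induced [DiffeologicalSpace Z] (f : X → Z) : DiffeologicalSpace X where
  plots n := {p | IsPlot (f ∘ p)}
  constant_plots x := isPlot_const (x := f x)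
  plot_reparam {_ _ p _} hp hf := isPlot_reparam (p := f ∘ p) hp hf
  locality hp := DiffeologicalSpace.locality fun x => by
    obtain ⟨u, hu, hx, h⟩ := hp x
    exact ⟨u, hu, hx, fun hm hs => h hm hs⟩

/-- The pushforward diffeology: the finest diffeology on `Z` that makes `f : X → Z` smooth.
Its plots are the maps that locally lift along `f` to a plot of `X` or are constant. -/
@[reducible] def pushforward [DiffeologicalSpace X] (f : X → Z) : DiffeologicalSpace Z :=
  ofLocal (fun n => {q | (∃ p : E n → X, IsPlot p ∧ q = f ∘ p) ∨ ∃ c, q = fun _ => c})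
    (fun _ x => Or.inr ⟨x, rfl⟩)
    (by
      rintro n m _ g (⟨p, hp, rfl⟩ | ⟨c, rfl⟩) hg
      · exact Or.inl ⟨p ∘ g, isPlot_reparam hp hg, rfl⟩
      · exact Or.inr ⟨c, rfl⟩)

/-- The subset diffeology. -/
instance [DiffeologicalSpace X] (Y : Set X) : DiffeologicalSpace Y :=
  induced (Subtype.val : Y → X)

/-- The product diffeology. -/
instance [DiffeologicalSpace X] [DiffeologicalSpace Z] : DiffeologicalSpace (X × Z) :=
  induced (Prod.fst : X × Z → X) ⊓ induced (Prod.snd : X × Z → Z)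

/-- The disjoint union diffeology: locally a plot is a plot of one of the two summands. -/
instance [DiffeologicalSpace X] [DiffeologicalSpace Z] : DiffeologicalSpace (X ⊕ Z) :=
  ofLocal (fun n => {q | (∃ p : E n → X, IsPlot p ∧ q = Sum.inl ∘ p) ∨
      ∃ p : E n → Z, IsPlot p ∧ q = Sum.inr ∘ p})
    (by
      rintro n (x | z)
      · exact Or.inl ⟨fun _ => x, isPlot_const, rfl⟩
      · exact Or.inr ⟨fun _ => z, isPlot_const, rfl⟩)
    (by
      rintro n m _ g (⟨p, hp, rfl⟩ | ⟨p, hp, rfl⟩) hg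
      · exact Or.inl ⟨p ∘ g, isPlot_reparam hp hg, rfl⟩
      · exact Or.inr ⟨p ∘ g, isPlot_reparam hp hg, rfl⟩)

theorem isPlot_of_mem {S : ∀ n, Set (E n → X)} {hc hr} {n : ℕ} {p : E n → X} (hp : p ∈ S n) :
    @IsPlot X (ofLocal S hc hr) n p :=
  fun _ => ⟨Set.univ, isOpen_univ, trivial, fun _ f _ hf => hr _ _ p f hp hf⟩

theorem dSmooth_pushforward [DiffeologicalSpace X] (f : X → Z) :
    @DSmooth X Z _ (pushforward f) f :=
  fun _ p hp => isPlot_of_mem (Or.inl ⟨p, hp, rfl⟩)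

/-- The universal property of the pushforward diffeology. -/
theorem pushforward_le_iff [DiffeologicalSpace X] (f : X → Z) (d : DiffeologicalSpace Z) :
    pushforward f ≤ d ↔ @DSmooth X Z _ d f := by
  rw [DiffeologicalSpace.le_iff']
  constructor
  · exact fun h n p hp => h n _ (dSmooth_pushforward f n p hp)
  · intro h n q hq
    refine DiffeologicalSpace.locality fun x => ?_
    obtain ⟨u, hu, hx, hl⟩ := hq x
    refine ⟨u, hu, hx, fun {m g} hg hgs => ?_⟩
    rcases hl m g hg hgs with ⟨p, hp, he⟩ | ⟨c, he⟩
    · rw [he]; exact h m p hp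
    · rw [he]; exact isPlot_const

theorem isPlot_prod_iff [DiffeologicalSpace X] [DiffeologicalSpace Z] {n : ℕ}
    {p : E n → X × Z} : IsPlot p ↔ IsPlot (Prod.fst ∘ p) ∧ IsPlot (Prod.snd ∘ p) :=
  DiffeologicalSpace.isPlot_inf_iff

end Constructions

/-! ### Local characterizations -/

section Local

variable {X Z : Type*}

theorem isPlot_pushforward_iff [DiffeologicalSpace X] {f : X → Z} (hf : Function.Surjective f)
    {n : ℕ} {q : E n → Z} :
    @IsPlot Z (pushforward f) n q ↔ ∀ x : E n, ∃ u : Set (E n), IsOpen u ∧ x ∈ u ∧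
      ∀ m (g : E m → E n), (∀ y, g y ∈ u) → ContDiff ℝ ∞ g →
        ∃ p : E m → X, IsPlot p ∧ q ∘ g = f ∘ p := by
  constructor
  · intro h x
    obtain ⟨u, hu, hx, hl⟩ := h x
    refine ⟨u, hu, hx, fun m g hg hgs => ?_⟩
    rcases hl m g hg hgs with ⟨p, hp, he⟩ | ⟨c, he⟩
    · exact ⟨p, hp, he⟩
    · obtain ⟨a, rfl⟩ := hf c
      exact ⟨fun _ => a, isPlot_const, he⟩
  · intro h x
    obtain ⟨u, hu, hx, hl⟩ := h x
    exact ⟨u, hu, hx, fun m g hg hgs => Or.inl (hl m g hg hgs)⟩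

theorem isPlot_of_local [DiffeologicalSpace X] {n : ℕ} {p : E n → X}
    (h : ∀ x : E n, ∃ u : Set (E n), IsOpen u ∧ x ∈ u ∧
      ∀ m (g : E m → E n), (∀ y, g y ∈ u) → ContDiff ℝ ∞ g → IsPlot (p ∘ g)) : IsPlot p :=
  DiffeologicalSpace.locality fun x => by
    obtain ⟨u, hu, hx, hl⟩ := h x
    exact ⟨u, hu, hx, fun {m g} hg hgs => hl m g hg hgs⟩

theorem contDiff_of_local {n : ℕ} {h : E n → ℝ}
    (hh : ∀ x : E n, ∃ u : Set (E n), IsOpen u ∧ x ∈ u ∧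
      ∀ m (g : E m → E n), (∀ y, g y ∈ u) → ContDiff ℝ ∞ g → ContDiff ℝ ∞ (h ∘ g)) :
    ContDiff ℝ ∞ h :=
  (isPlot_of_local (X := ℝ) fun x => by
    obtain ⟨u, hu, hx, hl⟩ := hh x
    exact ⟨u, hu, hx, fun m g hg hgs => (hl m g hg hgs).isPlot⟩).contDiff

end Local

/-! ### Diffeological vector pseudo-bundles and their sections -/

/-- A diffeological vector pseudo-bundle over `X`, given by its fibres and by a diffeology on its
total space for which the projection, the fibrewise addition, the scalar multiplication and the
zero section are smooth. Local triviality is not required. -/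
structure PseudoBundle (X : Type u) [DiffeologicalSpace X] where
  /-- The fibres. -/
  Fib : X → Type v
  [addCommGroup : ∀ x, AddCommGroup (Fib x)]
  [module : ∀ x, Module ℝ (Fib x)]
  /-- The diffeology of the total space. -/
  [diffeology : DiffeologicalSpace (Σ x, Fib x)]
  smooth_proj : DSmooth (Sigma.fst : (Σ x, Fib x) → X)
  smooth_add : ∀ (n : ℕ) (b : E n → X) (v w : ∀ r, Fib (b r)),
    IsPlot (fun r => (⟨b r, v r⟩ : Σ x, Fib x)) → IsPlot (fun r => (⟨b r, w r⟩ : Σ x, Fib x)) →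
      IsPlot (fun r => (⟨b r, v r + w r⟩ : Σ x, Fib x))
  smooth_smul : ∀ (n : ℕ) (b : E n → X) (c : E n → ℝ) (v : ∀ r, Fib (b r)), ContDiff ℝ ∞ c →
    IsPlot (fun r => (⟨b r, v r⟩ : Σ x, Fib x)) →
      IsPlot (fun r => (⟨b r, c r • v r⟩ : Σ x, Fib x))
  smooth_zero : ∀ (n : ℕ) (b : E n → X), IsPlot b →
    IsPlot (fun r => (⟨b r, 0⟩ : Σ x, Fib x))

attribute [instance] PseudoBundle.addCommGroup PseudoBundle.module PseudoBundle.diffeology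

section Bundles

variable {X : Type u} [DiffeologicalSpace X]

/-- The family of vectors `v` along `b` is a plot of the total space. -/
def PseudoBundle.PlotOver (B : PseudoBundle.{u, v} X) {n : ℕ} (b : E n → X)
    (v : ∀ r, B.Fib (b r)) : Prop :=
  IsPlot (fun r => (⟨b r, v r⟩ : Σ x, B.Fib x))

theorem PseudoBundle.PlotOver.comp {B : PseudoBundle.{u, v} X} {n m : ℕ} {b : E n → X}
    {v : ∀ r, B.Fib (b r)} (h : B.PlotOver b v) {g : E m → E n} (hg : ContDiff ℝ ∞ g) :
    B.PlotOver (b ∘ g) (fun r => v (g r)) :=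
  isPlot_reparam (p := fun r => (⟨b r, v r⟩ : Σ x, B.Fib x)) h hg

theorem PseudoBundle.PlotOver.base {B : PseudoBundle.{u, v} X} {n : ℕ} {b : E n → X}
    {v : ∀ r, B.Fib (b r)} (h : B.PlotOver b v) : IsPlot b :=
  B.smooth_proj n _ h

/-- The space of smooth sections, as a subspace of the space of all sections. -/
def secSubmodule (B : PseudoBundle.{u, v} X) : Submodule ℝ (∀ x, B.Fib x) where
  carrier := {s | DSmooth (fun x => (⟨x, s x⟩ : Σ x, B.Fib x))}
  add_mem' {s t} hs ht n p hp :=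
    B.smooth_add n p (fun r => s (p r)) (fun r => t (p r)) (hs n p hp) (ht n p hp)
  zero_mem' n p hp := B.smooth_zero n p hp
  smul_mem' c s hs n p hp :=
    B.smooth_smul n p (fun _ => c) (fun r => s (p r)) contDiff_const (hs n p hp)

/-- The vector space `C^∞(X, V)` of smooth sections of a pseudo-bundle. -/
def Sec (B : PseudoBundle.{u, v} X) : Type (max u v) := ↥(secSubmodule B)

instance (B : PseudoBundle.{u, v} X) : AddCommGroup (Sec B) :=
  inferInstanceAs (AddCommGroup ↥(secSubmodule B))

instance (B : PseudoBundle.{u, v} X) : Module ℝ (Sec B) :=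
  inferInstanceAs (Module ℝ ↥(secSubmodule B))

/-- The values of a smooth section. -/
def Sec.toFun {B : PseudoBundle.{u, v} X} (s : Sec B) : ∀ x, B.Fib x := s.1

instance (B : PseudoBundle.{u, v} X) : CoeFun (Sec B) (fun _ => ∀ x, B.Fib x) :=
  ⟨Sec.toFun⟩

/-- A smooth section from its values. -/
def Sec.mk {B : PseudoBundle.{u, v} X} (s : ∀ x, B.Fib x)
    (hs : DSmooth (fun x => (⟨x, s x⟩ : Σ x, B.Fib x))) : Sec B := ⟨s, hs⟩

theorem Sec.plotOver {B : PseudoBundle.{u, v} X} (s : Sec B) {n : ℕ} {p : E n → X}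
    (hp : IsPlot p) : B.PlotOver p (fun r => s (p r)) :=
  s.2 n p hp

/-- The functional diffeology on the space of smooth sections: `φ` is a plot when
`(r, x) ↦ φ r x` is smooth on the product of the parameter space and `X`. -/
instance (B : PseudoBundle.{u, v} X) : DiffeologicalSpace (Sec B) where
  plots m := {φ | ∀ (k : ℕ) (a : E k → E m) (p : E k → X), ContDiff ℝ ∞ a → IsPlot p →
    B.PlotOver p (fun r => φ (a r) (p r))}
  constant_plots s _ _ p _ hp := s.plotOver hp
  plot_reparam {_ _ _ f} hφ hf k a p ha hp := hφ k (f ∘ a) p (hf.comp ha) hp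
  locality {m φ} h k a p ha hp := by
    refine isPlot_of_local fun x => ?_
    obtain ⟨s, hs, hx, hl⟩ := h (a x)
    refine ⟨a ⁻¹' s, hs.preimage ha.continuous, hx, fun l g hg hgs => ?_⟩
    exact hl (f := a ∘ g) hg (ha.comp hgs) l id (p ∘ g) contDiff_id (isPlot_reparam hp hgs)

/-- The product of a smooth function and a smooth section. -/
def Sec.funSMul {B : PseudoBundle.{u, v} X} (h : X → ℝ) (hh : DSmooth h) (s : Sec B) : Sec B :=
  Sec.mk (fun x => h x • s x) fun n p hp =>
    B.smooth_smul n p (h ∘ p) (fun r => s (p r)) (hh n p hp).contDiff (s.plotOver hp)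

/-! ### Dual and tensor product pseudo-bundles -/

/-- The smooth linear functionals on the fibre at `x`, which carries the subset diffeology. -/
def smoothDual (B : PseudoBundle.{u, v} X) (x : X) : Submodule ℝ (Module.Dual ℝ (B.Fib x)) where
  carrier := {l | ∀ (n : ℕ) (v : E n → B.Fib x), B.PlotOver (fun _ => x) v →
    ContDiff ℝ ∞ (fun r => l (v r))}
  add_mem' hl hl' n v hv := (hl n v hv).add (hl' n v hv)
  zero_mem' _ _ _ := contDiff_const
  smul_mem' _ _ hl n v hv := contDiff_const.mul (hl n v hv)

/-- The dual pseudo-bundle: its fibres are the smooth duals of the fibres, and a family of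
functionals is a plot when its values on all plots of the original pseudo-bundle (over a smooth
reparametrization of the same base plot) are smooth. -/
@[reducible] def dualBundle (B : PseudoBundle.{u, v} X) : PseudoBundle.{u, v} X where
  Fib x := ↥(smoothDual B x)
  diffeology :=
    { plots := fun n => {q | IsPlot (fun r => (q r).1) ∧
        ∀ (k : ℕ) (a : E k → E n) (w : ∀ r, B.Fib (q (a r)).1), ContDiff ℝ ∞ a →
          B.PlotOver (fun r => (q (a r)).1) w → ContDiff ℝ ∞ (fun r => (q (a r)).2.1 (w r))}
      constant_plots := fun x => ⟨isPlot_const, fun k _ w _ hw => x.2.2 k w hw⟩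
      plot_reparam := fun {n m p f} hp hf => ⟨isPlot_reparam (p := fun r => (p r).1) hp.1 hf,
        fun k a w ha hw => hp.2 k (f ∘ a) w (hf.comp ha) hw⟩
      locality := fun {n p} h => by
        constructor
        · refine isPlot_of_local fun x => ?_
          obtain ⟨s, hs, hx, hl⟩ := h x
          exact ⟨s, hs, hx, fun m g hg hgs => (hl hg hgs).1⟩
        · intro k a w ha hw
          refine contDiff_of_local fun x => ?_
          obtain ⟨s, hs, hx, hl⟩ := h (a x)
          refine ⟨a ⁻¹' s, hs.preimage ha.continuous, hx, fun m g hg hgs => ?_⟩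
          exact (hl (f := a ∘ g) hg (ha.comp hgs)).2 m id (fun r => w (g r)) contDiff_id
            (hw.comp hgs) }
  smooth_proj n q hq := hq.1
  smooth_add n b v w hv hw := ⟨hv.1, fun k a z ha hz => (hv.2 k a z ha hz).add (hw.2 k a z ha hz)⟩
  smooth_smul n b c v hc hv := ⟨hv.1, fun k a z ha hz => (hc.comp ha).mul (hv.2 k a z ha hz)⟩
  smooth_zero n b hb := ⟨hb, fun k a z ha hz => contDiff_const⟩

/-- The families of tensors along `b` that are finite sums of `v ⊗ w` with `v`, `w` plots. -/
def tensorPlots (A : PseudoBundle.{u, v} X) (B : PseudoBundle.{u, w} X) {n : ℕ} (b : E n → X) :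
    Submodule ℝ (∀ r, A.Fib (b r) ⊗[ℝ] B.Fib (b r)) :=
  Submodule.span ℝ {t | ∃ (v : ∀ r, A.Fib (b r)) (w : ∀ r, B.Fib (b r)),
    A.PlotOver b v ∧ B.PlotOver b w ∧ t = fun r => v r ⊗ₜ[ℝ] w r}

theorem tensorPlots_comp (A : PseudoBundle.{u, v} X) (B : PseudoBundle.{u, w} X) {n m : ℕ}
    {b : E n → X} {t : ∀ r, A.Fib (b r) ⊗[ℝ] B.Fib (b r)} (ht : t ∈ tensorPlots A B b)
    {g : E m → E n} (hg : ContDiff ℝ ∞ g) :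
    (fun r => t (g r)) ∈ tensorPlots A B (b ∘ g) := by
  induction ht using Submodule.span_induction with
  | mem t ht =>
    obtain ⟨v, w, hv, hw, rfl⟩ := ht
    exact Submodule.subset_span ⟨_, _, hv.comp hg, hw.comp hg, rfl⟩
  | zero => exact Submodule.zero_mem _
  | add s t _ _ hs ht => exact Submodule.add_mem _ hs ht
  | smul c t _ ht => exact Submodule.smul_mem _ c ht

theorem tensorPlots_smul (A : PseudoBundle.{u, v} X) (B : PseudoBundle.{u, w} X) {n : ℕ}
    {b : E n → X} {t : ∀ r, A.Fib (b r) ⊗[ℝ] B.Fib (b r)} (ht : t ∈ tensorPlots A B b)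
    {c : E n → ℝ} (hc : ContDiff ℝ ∞ c) :
    (fun r => c r • t r) ∈ tensorPlots A B b := by
  induction ht using Submodule.span_induction with
  | mem t ht =>
    obtain ⟨v, w, hv, hw, rfl⟩ := ht
    exact Submodule.subset_span ⟨_, _, A.smooth_smul n b c v hc hv, hw, rfl⟩
  | zero =>
    convert Submodule.zero_mem (tensorPlots A B b) using 1
    funext r
    exact smul_zero _
  | add s t _ _ hs ht =>
    convert Submodule.add_mem _ hs ht using 1
    funext r
    exact smul_add _ _ _
  | smul a t _ ht =>
    convert Submodule.smul_mem _ a ht using 1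
    funext r
    exact smul_comm (c r) a (t r)

theorem tensorPlots_const (A : PseudoBundle.{u, v} X) (B : PseudoBundle.{u, w} X) (n : ℕ) (x : X)
    (t : A.Fib x ⊗[ℝ] B.Fib x) :
    (fun _ => t) ∈ tensorPlots A B (fun _ : E n => x) := by
  induction t using TensorProduct.induction_on with
  | zero => exact Submodule.zero_mem _
  | tmul v w =>
    exact Submodule.subset_span ⟨fun _ => v, fun _ => w,
      isPlot_const (x := (⟨x, v⟩ : Σ x, A.Fib x)), isPlot_const (x := (⟨x, w⟩ : Σ x, B.Fib x)), rfl⟩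
  | add s t hs ht => exact Submodule.add_mem _ hs ht

/-- The tensor product pseudo-bundle: its plots are, locally, finite sums of tensor products of
plots of the factors over the same base plot. This is the finest pseudo-bundle diffeology for
which `(v, w) ↦ v ⊗ w` is smooth on the fibrewise product. -/
@[reducible] def tensorBundle (A : PseudoBundle.{u, v} X) (B : PseudoBundle.{u, w} X) :
    PseudoBundle.{u, max v w} X where
  Fib x := A.Fib x ⊗[ℝ] B.Fib x
  diffeology := ofLocal
    (fun n => {q | IsPlot (fun r : E n => (q r).1) ∧
      (fun r => (q r).2) ∈ tensorPlots A B (fun r : E n => (q r).1)})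
    (fun n x => ⟨isPlot_const, tensorPlots_const A B n x.1 x.2⟩)
    (fun n m p g hp hg => ⟨isPlot_reparam (p := fun r => (p r).1) hp.1 hg,
      tensorPlots_comp A B hp.2 hg⟩)
  smooth_proj n q hq := isPlot_of_local fun x => by
    obtain ⟨s, hs, hx, hl⟩ := hq x
    exact ⟨s, hs, hx, fun m g hg hgs => (hl m g hg hgs).1⟩
  smooth_add n b v w hv hw x := by
    obtain ⟨s, hs, hx, hl⟩ := hv x
    obtain ⟨s', hs', hx', hl'⟩ := hw x
    refine ⟨s ∩ s', hs.inter hs', ⟨hx, hx'⟩, fun m g hg hgs => ?_⟩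
    have h1 := hl m g (fun y => (hg y).1) hgs
    have h2 := hl' m g (fun y => (hg y).2) hgs
    exact ⟨h1.1, Submodule.add_mem _ h1.2 h2.2⟩
  smooth_smul n b c v hc hv x := by
    obtain ⟨s, hs, hx, hl⟩ := hv x
    refine ⟨s, hs, hx, fun m g hg hgs => ?_⟩
    have h1 := hl m g hg hgs
    exact ⟨h1.1, tensorPlots_smul A B h1.2 (hc.comp hgs)⟩
  smooth_zero n b hb :=
    isPlot_of_mem ⟨hb, Submodule.zero_mem _⟩

end Bundles

/-! ### Differential 1-forms -/

section Forms

variable {X : Type u} [DiffeologicalSpace X]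

/-- Differential `1`-forms on a diffeological space: families of smooth `1`-forms `θ(p)` on the
domains of the plots `p` such that `θ(p ∘ g) = g^* (θ(p))` for all smooth `g`. -/
structure IsForm (θ : ∀ n, {p : E n → X // IsPlot p} → E n → (E n →L[ℝ] ℝ)) : Prop where
  smooth : ∀ n p, ContDiff ℝ ∞ (θ n p)
  comp : ∀ (n m : ℕ) (p : {p : E n → X // IsPlot p}) (g : E m → E n) (hg : ContDiff ℝ ∞ g)
    (r : E m), θ m ⟨p.1 ∘ g, isPlot_reparam p.2 hg⟩ r = (θ n p (g r)).comp (fderiv ℝ g r)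

/-- Differential `1`-forms, as a subspace. -/
def formSubmodule (X : Type u) [DiffeologicalSpace X] :
    Submodule ℝ (∀ n, {p : E n → X // IsPlot p} → E n → (E n →L[ℝ] ℝ)) where
  carrier := {θ | IsForm θ}
  add_mem' {θ η} hθ hη := ⟨fun n p => (hθ.1 n p).add (hη.1 n p), fun n m p g hg r => by
    simp only [Pi.add_apply, hθ.2 n m p g hg r, hη.2 n m p g hg r, ContinuousLinearMap.add_comp]⟩
  zero_mem' := ⟨fun n p => contDiff_const, fun n m p g hg r => by
    simp only [Pi.zero_apply, ContinuousLinearMap.zero_comp]⟩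
  smul_mem' c θ hθ := ⟨fun n p => (hθ.1 n p).const_smul c, fun n m p g hg r => by
    simp only [Pi.smul_apply, hθ.2 n m p g hg r, ContinuousLinearMap.smul_comp]⟩

/-- The vector space `Ω¹(X)` of differential `1`-forms. -/
def Form (X : Type u) [DiffeologicalSpace X] : Type u := ↥(formSubmodule X)

instance : AddCommGroup (Form X) := inferInstanceAs (AddCommGroup ↥(formSubmodule X))

instance : Module ℝ (Form X) := inferInstanceAs (Module ℝ ↥(formSubmodule X))

/-- The value of a form on a plot. -/
def Form.eval (θ : Form X) {n : ℕ} (p : E n → X) (hp : IsPlot p) : E n → (E n →L[ℝ] ℝ) :=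
  θ.1 n ⟨p, hp⟩

theorem Form.isForm (θ : Form X) : IsForm θ.1 := θ.2

/-- The functional diffeology on `Ω¹(X)`. -/
instance : DiffeologicalSpace (Form X) where
  plots m := {φ | ∀ (n : ℕ) (p : E n → X) (hp : IsPlot p),
    ContDiff ℝ ∞ (fun z : E m × E n => (φ z.1).eval p hp z.2)}
  constant_plots θ n p hp := (θ.isForm.smooth n ⟨p, hp⟩).comp contDiff_snd
  plot_reparam {_ _ _ f} hφ hf n p hp := (hφ n p hp).comp ((hf.comp contDiff_fst).prodMk contDiff_snd)
  locality {m φ} h n p hp := by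
    rw [contDiff_iff_contDiffAt]
    rintro ⟨x, r⟩
    obtain ⟨s, hs, hx, hl⟩ := h x
    obtain ⟨ε, hε, hb⟩ := Metric.isOpen_iff.mp hs x hx
    have hmem : ∀ y, OpenPartialHomeomorph.univBall x ε y ∈ Metric.ball x ε := fun y => by
      have := (OpenPartialHomeomorph.univBall x ε).map_source (x := y) (by simp)
      rwa [OpenPartialHomeomorph.univBall_target x hε] at this
    have h1 := hl (f := OpenPartialHomeomorph.univBall x ε) (fun y => hb (hmem y))
      OpenPartialHomeomorph.contDiff_univBall n p hp
    have hsm : ContDiffAt ℝ ∞ (OpenPartialHomeomorph.univBall x ε).symm x :=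
      (OpenPartialHomeomorph.contDiffOn_univBall_symm (c := x) (r := ε)).contDiffAt
        (Metric.ball_mem_nhds x hε)
    have h2 : ContDiffAt ℝ ∞ (fun z : E m × E n =>
        ((OpenPartialHomeomorph.univBall x ε).symm z.1, z.2)) (x, r) :=
      (hsm.comp (x, r) contDiffAt_fst).prodMk contDiffAt_snd
    refine (h1.contDiffAt.comp (x, r) h2).congr_of_eventuallyEq ?_
    have h3 : ∀ᶠ z : E m × E n in nhds (x, r), z.1 ∈ Metric.ball x ε :=
      continuous_fst.continuousAt.eventually (Metric.ball_mem_nhds x hε)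
    filter_upwards [h3] with z hz
    simp only [Function.comp_apply]
    rw [(OpenPartialHomeomorph.univBall x ε).right_inv]
    rwa [OpenPartialHomeomorph.univBall_target x hε]

theorem isPlot_form_add {m : ℕ} {φ ψ : E m → Form X} (hφ : IsPlot φ) (hψ : IsPlot ψ) :
    IsPlot (fun r => φ r + ψ r) :=
  fun n p hp => (hφ n p hp).add (hψ n p hp)

theorem isPlot_form_smul {m : ℕ} {c : E m → ℝ} {φ : E m → Form X} (hc : ContDiff ℝ ∞ c)
    (hφ : IsPlot φ) : IsPlot (fun r => c r • φ r) :=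
  fun n p hp => (hc.comp contDiff_fst).smul (hφ n p hp)

/-- The forms that vanish at `x`: those with `θ(p)(0) = 0` for every plot `p` with `p(0) = x`. -/
def vanishingAt (x : X) : Submodule ℝ (Form X) where
  carrier := {θ | ∀ (n : ℕ) (p : E n → X) (hp : IsPlot p), p 0 = x → θ.eval p hp 0 = 0}
  add_mem' {θ η} hθ hη n p hp h := by
    have h1 := hθ n p hp h
    have h2 := hη n p hp h
    change θ.eval p hp 0 + η.eval p hp 0 = 0
    rw [h1, h2, add_zero]
  zero_mem' _ _ _ _ := rfl
  smul_mem' c θ hθ n p hp h := by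
    change c • θ.eval p hp 0 = 0
    rw [hθ n p hp h, smul_zero]

/-- The fibre `Λ¹_x(X) = Ω¹(X) / Ω¹_x(X)` of values of `1`-forms at `x`. -/
abbrev CotangentAt (x : X) : Type u := Form X ⧸ vanishingAt x

/-- The value of a form at `x`. -/
def valueAt (x : X) : Form X →ₗ[ℝ] CotangentAt x := (vanishingAt x).mkQ

/-- The defining projection `X × Ω¹(X) → Λ¹(X)`. -/
def cotangentProj (a : X × Form X) : Σ x : X, CotangentAt x := ⟨a.1, valueAt a.1 a.2⟩

theorem cotangentProj_surjective : Function.Surjective (cotangentProj (X := X)) := by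
  rintro ⟨x, α⟩
  obtain ⟨θ, rfl⟩ := Submodule.mkQ_surjective _ α
  exact ⟨(x, θ), rfl⟩

theorem cotangentProj_add {x : X} {α β : CotangentAt x} {a b : X × Form X}
    (ha : (⟨x, α⟩ : Σ x : X, CotangentAt x) = cotangentProj a)
    (hb : (⟨x, β⟩ : Σ x : X, CotangentAt x) = cotangentProj b) :
    (⟨x, α + β⟩ : Σ x : X, CotangentAt x) = cotangentProj (a.1, a.2 + b.2) := by
  obtain ⟨a1, a2⟩ := a
  obtain ⟨b1, b2⟩ := b
  simp only [cotangentProj, Sigma.mk.injEq] at ha hb ⊢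
  obtain ⟨rfl, ha⟩ := ha
  obtain ⟨rfl, hb⟩ := hb
  refine ⟨rfl, ?_⟩
  rw [eq_of_heq ha, eq_of_heq hb, map_add]

theorem cotangentProj_smul {x : X} {α : CotangentAt x} {a : X × Form X} (c : ℝ)
    (ha : (⟨x, α⟩ : Σ x : X, CotangentAt x) = cotangentProj a) :
    (⟨x, c • α⟩ : Σ x : X, CotangentAt x) = cotangentProj (a.1, c • a.2) := by
  obtain ⟨a1, a2⟩ := a
  simp only [cotangentProj, Sigma.mk.injEq] at ha ⊢
  obtain ⟨rfl, ha⟩ := ha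
  refine ⟨rfl, ?_⟩
  rw [eq_of_heq ha, map_smul]

/-- The pseudo-bundle `Λ¹(X)` of values of `1`-forms, with the quotient diffeology
of `X × Ω¹(X)`. -/
@[reducible] def cotangentBundle (X : Type u) [DiffeologicalSpace X] : PseudoBundle.{u, u} X where
  Fib x := CotangentAt x
  diffeology := pushforward cotangentProj
  smooth_proj := by
    have h : pushforward cotangentProj ≤
        induced (Sigma.fst : (Σ x : X, CotangentAt x) → X) :=
      (pushforward_le_iff _ _).mpr fun n p hp => (isPlot_prod_iff.mp hp).1
    exact fun n q hq => DiffeologicalSpace.le_iff'.mp h n q hq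
  smooth_add n b v w hv hw := by
    rw [isPlot_pushforward_iff cotangentProj_surjective] at hv hw ⊢
    intro x
    obtain ⟨s, hs, hx, hl⟩ := hv x
    obtain ⟨s', hs', hx', hl'⟩ := hw x
    refine ⟨s ∩ s', hs.inter hs', ⟨hx, hx'⟩, fun m g hg hgs => ?_⟩
    obtain ⟨p, hp, he⟩ := hl m g (fun y => (hg y).1) hgs
    obtain ⟨p', hp', he'⟩ := hl' m g (fun y => (hg y).2) hgs
    refine ⟨fun r => ((p r).1, (p r).2 + (p' r).2), ?_, ?_⟩
    · rw [isPlot_prod_iff] at hp hp' ⊢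
      exact ⟨hp.1, isPlot_form_add hp.2 hp'.2⟩
    · exact funext fun r => cotangentProj_add (congrFun he r) (congrFun he' r)
  smooth_smul n b c v hc hv := by
    rw [isPlot_pushforward_iff cotangentProj_surjective] at hv ⊢
    intro x
    obtain ⟨s, hs, hx, hl⟩ := hv x
    refine ⟨s, hs, hx, fun m g hg hgs => ?_⟩
    obtain ⟨p, hp, he⟩ := hl m g hg hgs
    refine ⟨fun r => ((p r).1, c (g r) • (p r).2), ?_, ?_⟩
    · rw [isPlot_prod_iff] at hp ⊢
      exact ⟨hp.1, isPlot_form_smul (hc.comp hgs) hp.2⟩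
    · exact funext fun r => cotangentProj_smul _ (congrFun he r)
  smooth_zero n b hb := by
    refine isPlot_of_mem (Or.inl ⟨fun r => (b r, 0), ?_, ?_⟩)
    · exact isPlot_prod_iff.mpr ⟨hb, isPlot_const⟩
    · exact funext fun r => by simp [cotangentProj]

/-- The pullback of forms along a smooth map. -/
def pullback {Z : Type w} [DiffeologicalSpace Z] (h : X → Z) (hh : DSmooth h) :
    Form Z →ₗ[ℝ] Form X where
  toFun θ := ⟨fun n p => θ.eval (h ∘ p.1) (hh n p.1 p.2), IsForm.mk
    (fun n p => θ.isForm.smooth n ⟨h ∘ p.1, hh n p.1 p.2⟩)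
    (fun n m p g hg r => θ.isForm.comp n m ⟨h ∘ p.1, hh n p.1 p.2⟩ g hg r)⟩
  map_add' _ _ := rfl
  map_smul' _ _ := rfl

/-- The map `Λ¹_z(Z) → Λ¹_x(X)` induced by the pullback along a smooth map `h` with `h x = z`. -/
def pullbackAt {Z : Type w} [DiffeologicalSpace Z] (h : X → Z) (hh : DSmooth h) {x : X} {z : Z}
    (e : h x = z) : CotangentAt z →ₗ[ℝ] CotangentAt x :=
  Submodule.mapQ _ _ (pullback h hh) fun θ hθ n p hp hx =>
    hθ n (h ∘ p) (hh n p hp) (by rw [Function.comp_apply, hx, e])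

/-- The differential of a smooth function, as a `1`-form. -/
def differential (h : X → ℝ) (hh : DSmooth h) : Form X :=
  ⟨fun n p r => fderiv ℝ (h ∘ p.1) r, IsForm.mk
    (fun n p => (hh n p.1 p.2).contDiff.fderiv_right (by simp))
    (fun n m p g hg r => fderiv_comp r
      ((hh n p.1 p.2).contDiff.differentiable (by simp) (g r)) (hg.differentiable (by simp) r))⟩

end Forms

/-! ### Connections and pseudo-metrics -/

section Connections

variable {X : Type u} [DiffeologicalSpace X]

/-- The pseudo-bundle `Λ¹(X) ⊗ V`. -/
abbrev formsWith (B : PseudoBundle.{u, v} X) : PseudoBundle.{u, max u v} X :=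
  tensorBundle (cotangentBundle X) B

/-- A diffeological connection: a smooth linear operator `C^∞(X, V) → C^∞(X, Λ¹(X) ⊗ V)` that
satisfies the Leibniz rule `∇(h s) = dh ⊗ s + h ∇s`. -/
structure Connection (B : PseudoBundle.{u, v} X) where
  /-- The underlying linear operator. -/
  toLin : Sec B →ₗ[ℝ] Sec (formsWith B)
  smooth : DSmooth toLin
  leibniz : ∀ (h : X → ℝ) (hh : DSmooth h) (s : Sec B) (x : X),
    toLin (Sec.funSMul h hh s) x =
      valueAt x (differential h hh) ⊗ₜ[ℝ] s x + h x • toLin s x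

/-- A pseudo-metric on a pseudo-bundle with finite-dimensional fibres: a smooth section of
`V^* ⊗ V^*` whose values are symmetric positive semidefinite bilinear forms on the fibres, with
kernel of the least possible dimension `dim V_x - dim V_x^*`. -/
structure IsPseudoMetric (B : PseudoBundle.{u, v} X)
    (g : ∀ x, LinearMap.BilinForm ℝ (B.Fib x)) : Prop where
  smooth : ∃ σ : Sec (tensorBundle (dualBundle B) (dualBundle B)), ∀ x (v w : B.Fib x),
    g x v w = TensorProduct.dualDistrib ℝ (B.Fib x) (B.Fib x)
      (TensorProduct.map (smoothDual B x).subtype (smoothDual B x).subtype (σ x)) (v ⊗ₜ[ℝ] w)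
  symm : ∀ x (v w : B.Fib x), g x v w = g x w v
  nonneg : ∀ x (v : B.Fib x), 0 ≤ g x v v
  rank : ∀ x, Module.finrank ℝ (LinearMap.ker (g x)) + Module.finrank ℝ (smoothDual B x) =
    Module.finrank ℝ (B.Fib x)

/-- The contraction `Λ¹_x(X) ⊗ V_x → Λ¹_x(X)`, `α ⊗ v ↦ l(v) α`, with a linear functional. -/
def contract (B : PseudoBundle.{u, v} X) {x : X} (l : Module.Dual ℝ (B.Fib x)) :
    CotangentAt x ⊗[ℝ] B.Fib x →ₗ[ℝ] CotangentAt x :=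
  (TensorProduct.rid ℝ (CotangentAt x)).toLinearMap ∘ₗ LinearMap.lTensor (CotangentAt x) l

/-- An operator `N` from the smooth sections of `V` to the sections of `Λ¹(X) ⊗ V` is compatible
with `g` when `d(g(s, t)) = g(N s, t) + g(s, N t)` for all smooth sections `s`, `t`, where
`g(α ⊗ v, w) = g(v, α ⊗ w) = g(v, w) α`. -/
def MetricCompatible (B : PseudoBundle.{u, v} X)
    (N : Sec B → ∀ x, CotangentAt x ⊗[ℝ] B.Fib x)
    (g : ∀ x, LinearMap.BilinForm ℝ (B.Fib x)) : Prop :=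
  ∀ s t : Sec B, ∃ h : DSmooth (fun x => g x (s x) (t x)), ∀ x,
    valueAt x (differential (fun x => g x (s x) (t x)) h) =
      contract B ((g x).flip (t x)) (N s x) + contract B (g x (s x)) (N t x)

end Connections

/-! ### Gluing of diffeological spaces along a diffeomorphism -/

section Gluing

variable {X₁ : Type u₁} {X₂ : Type u₂} [DiffeologicalSpace X₁] [DiffeologicalSpace X₂]

/-- A gluing diffeomorphism of `X₁` to `X₂`: a map `f : Y → X₂`, defined on a subset `Y` of `X₁`,
which is a diffeomorphism of `Y` onto its image (for the subset diffeologies). -/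
structure Gluing (X₁ : Type u₁) (X₂ : Type u₂) [DiffeologicalSpace X₁]
    [DiffeologicalSpace X₂] where
  /-- The domain of gluing. -/
  Y : Set X₁
  /-- The gluing map. -/
  f : Y → X₂
  injective : Function.Injective f
  isPlot_iff : ∀ (n : ℕ) (b : E n → Y), IsPlot (f ∘ b) ↔ IsPlot b

/-- The underlying set of the space `X₁ ∪_f X₂`, the quotient of `X₁ ⊔ X₂` by `y ∼ f y`: it is the
disjoint union of the complement of `Y` in `X₁` and of `X₂`. -/
inductive Glued (G : Gluing X₁ X₂) : Type (max u₁ u₂)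
  | inl (x : X₁) (hx : x ∉ G.Y) : Glued G
  | inr (x : X₂) : Glued G

namespace Gluing

open Classical in
/-- The map `X₁ → X₁ ∪_f X₂`. -/
def i₁ (G : Gluing X₁ X₂) (x : X₁) : Glued G :=
  if h : x ∈ G.Y then .inr (G.f ⟨x, h⟩) else .inl x h

/-- The map `X₂ → X₁ ∪_f X₂`. -/
def i₂ (G : Gluing X₁ X₂) (x : X₂) : Glued G := .inr x

/-- The quotient projection `X₁ ⊔ X₂ → X₁ ∪_f X₂`. -/
def proj (G : Gluing X₁ X₂) : X₁ ⊕ X₂ → Glued G := Sum.elim G.i₁ G.i₂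

/-- The glued space carries the quotient diffeology. -/
instance (G : Gluing X₁ X₂) : DiffeologicalSpace (Glued G) := pushforward G.proj

variable (G : Gluing X₁ X₂)

theorem i₁_mem (y : G.Y) : G.i₁ y = .inr (G.f y) := dif_pos y.2

theorem i₁_notMem {x : X₁} (hx : x ∉ G.Y) : G.i₁ x = .inl x hx := dif_neg hx

theorem i₁_eq_inr {x : X₁} {z : X₂} (h : G.i₁ x = .inr z) : ∃ hx : x ∈ G.Y, G.f ⟨x, hx⟩ = z := by
  by_cases hx : x ∈ G.Y
  · rw [G.i₁_mem ⟨x, hx⟩] at h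
    exact ⟨hx, Glued.inr.inj h⟩
  · rw [G.i₁_notMem hx] at h
    cases h

theorem i₁_injective : Function.Injective G.i₁ := by
  intro x x' h
  by_cases hx : x ∈ G.Y
  · rw [G.i₁_mem ⟨x, hx⟩] at h
    obtain ⟨hx', e⟩ := G.i₁_eq_inr h.symm
    exact (congrArg Subtype.val (G.injective e)).symm
  · by_cases hx' : x' ∈ G.Y
    · rw [G.i₁_mem ⟨x', hx'⟩] at h
      exact absurd (G.i₁_eq_inr h).1 hx
    · rw [G.i₁_notMem hx, G.i₁_notMem hx'] at h
      exact (Glued.inl.inj h)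

theorem proj_surjective : Function.Surjective G.proj := by
  rintro (⟨x, hx⟩ | x)
  · exact ⟨.inl x, G.i₁_notMem hx⟩
  · exact ⟨.inr x, rfl⟩

/-- The glued space is the quotient of the disjoint union by the equivalence relation generated
by `y ∼ f y`. -/
theorem proj_eq_iff (a b : X₁ ⊕ X₂) : G.proj a = G.proj b ↔
    Relation.EqvGen (fun a b => ∃ y : G.Y, a = Sum.inl y.1 ∧ b = Sum.inr (G.f y)) a b := by
  constructor
  · intro h
    rcases a with x | x <;> rcases b with z | z
    · rw [G.i₁_injective h]
      exact .refl _
    · obtain ⟨hx, rfl⟩ := G.i₁_eq_inr h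
      exact .rel _ _ ⟨⟨x, hx⟩, rfl, rfl⟩
    · obtain ⟨hz, rfl⟩ := G.i₁_eq_inr h.symm
      exact .symm _ _ (.rel _ _ ⟨⟨z, hz⟩, rfl, rfl⟩)
    · rw [Glued.inr.inj h]
      exact .refl _
  · intro h
    induction h with
    | rel a b h =>
      obtain ⟨y, rfl, rfl⟩ := h
      exact G.i₁_mem y
    | refl a => rfl
    | symm a b _ h => exact h.symm
    | trans a b c _ _ h h' => exact h.trans h'

theorem isPlot_inl {n : ℕ} {p : E n → X₁} (hp : IsPlot p) :
    IsPlot (Sum.inl ∘ p : E n → X₁ ⊕ X₂) :=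
  fun _ => ⟨Set.univ, isOpen_univ, trivial, fun _ g _ hg =>
    Or.inl ⟨p ∘ g, isPlot_reparam hp hg, rfl⟩⟩

theorem isPlot_inr {n : ℕ} {p : E n → X₂} (hp : IsPlot p) :
    IsPlot (Sum.inr ∘ p : E n → X₁ ⊕ X₂) :=
  fun _ => ⟨Set.univ, isOpen_univ, trivial, fun _ g _ hg =>
    Or.inr ⟨p ∘ g, isPlot_reparam hp hg, rfl⟩⟩

theorem smooth_i₁ : DSmooth G.i₁ := fun n _ hp =>
  dSmooth_pushforward G.proj n _ (isPlot_inl hp)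

theorem smooth_i₂ : DSmooth G.i₂ := fun n _ hp =>
  dSmooth_pushforward G.proj n _ (isPlot_inr hp)

/-- The inclusion of the domain of gluing is smooth. -/
theorem smooth_val : DSmooth (Subtype.val : G.Y → X₁) := fun _ _ hp => hp

theorem smooth_f : DSmooth G.f := fun n p hp => (G.isPlot_iff n p).mpr hp

/-- The pullback `i^* : Ω¹(X₁) → Ω¹(Y)`. -/
def pull₁ : Form X₁ →ₗ[ℝ] Form G.Y := pullback Subtype.val G.smooth_val

/-- The pullback `f^* j^* : Ω¹(X₂) → Ω¹(Y)`. -/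
def pull₂ : Form X₂ →ₗ[ℝ] Form G.Y := pullback G.f G.smooth_f

/-- The pushforward to `Ω¹(Y)` of the diffeology of `Ω¹(X₁)`. -/
@[reducible] def D₁ : DiffeologicalSpace (Form G.Y) := pushforward G.pull₁

/-- The pushforward to `Ω¹(Y)` of the diffeology of `Ω¹(X₂)`. -/
@[reducible] def D₂ : DiffeologicalSpace (Form G.Y) := pushforward G.pull₂

/-- The pullback `Λ¹_y(X₁) → Λ¹_y(Y)` along the inclusion. -/
def pullΛ₁ (y : G.Y) : CotangentAt y.1 →ₗ[ℝ] CotangentAt y :=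
  pullbackAt Subtype.val G.smooth_val rfl

/-- The pullback `Λ¹_{f(y)}(X₂) → Λ¹_y(Y)` along `f`. -/
def pullΛ₂ (y : G.Y) : CotangentAt (G.f y) →ₗ[ℝ] CotangentAt y :=
  pullbackAt G.f G.smooth_f rfl

/-- The restriction `Λ¹_z(X₁ ∪_f X₂) → Λ¹_x(X₁)` of forms, where `z` is the class of `x`. -/
def ρ₁ {x : X₁} {z : Glued G} (e : G.i₁ x = z) : CotangentAt z →ₗ[ℝ] CotangentAt x :=
  pullbackAt G.i₁ G.smooth_i₁ e

/-- The restriction `Λ¹_z(X₁ ∪_f X₂) → Λ¹_x(X₂)` of forms, where `z` is the class of `x`. -/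
def ρ₂ (x : X₂) : CotangentAt (Glued.inr x : Glued G) →ₗ[ℝ] CotangentAt x :=
  pullbackAt G.i₂ G.smooth_i₂ rfl

end Gluing

/-! ### Gluing of pseudo-bundles -/

/-- A gluing of pseudo-bundles over `G`: a diffeomorphism `f̃ : π₁⁻¹(Y) → π₂⁻¹(f(Y))` over `f`,
linear on the fibres. -/
structure BundleGluing (G : Gluing X₁ X₂) (B₁ : PseudoBundle.{u₁, v} X₁)
    (B₂ : PseudoBundle.{u₂, v} X₂) where
  /-- The gluing map on the fibres. -/
  map : ∀ y : G.Y, B₁.Fib y.1 ≃ₗ[ℝ] B₂.Fib (G.f y)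
  plotOver_iff : ∀ (n : ℕ) (b : E n → G.Y) (v : ∀ r, B₁.Fib (b r).1),
    B₂.PlotOver (fun r => G.f (b r)) (fun r => map (b r) (v r)) ↔
      B₁.PlotOver (fun r => (b r).1) v

variable {G : Gluing X₁ X₂} {B₁ : PseudoBundle.{u₁, v} X₁} {B₂ : PseudoBundle.{u₂, v} X₂}

/-- The fibres of the glued pseudo-bundle. -/
@[reducible] def GluedFib (G : Gluing X₁ X₂) (B₁ : PseudoBundle.{u₁, v} X₁) (B₂ : PseudoBundle.{u₂, v} X₂) :
    Glued G → Type v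
  | .inl x _ => B₁.Fib x
  | .inr x => B₂.Fib x

instance : ∀ z, AddCommGroup (GluedFib G B₁ B₂ z)
  | .inl x _ => B₁.addCommGroup x
  | .inr x => B₂.addCommGroup x

instance : ∀ z, Module ℝ (GluedFib G B₁ B₂ z)
  | .inl x _ => B₁.module x
  | .inr x => B₂.module x

namespace BundleGluing

variable (H : BundleGluing G B₁ B₂)

open Classical in
/-- The map `V₁ → V₁ ∪ V₂`. -/
def j₁ (a : Σ x, B₁.Fib x) : Σ z, GluedFib G B₁ B₂ z :=
  if h : a.1 ∈ G.Y then ⟨.inr (G.f ⟨a.1, h⟩), H.map ⟨a.1, h⟩ a.2⟩ else ⟨.inl a.1 h, a.2⟩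

/-- The map `V₂ → V₁ ∪ V₂`. -/
def j₂ (_H : BundleGluing G B₁ B₂) (a : Σ x, B₂.Fib x) : Σ z, GluedFib G B₁ B₂ z :=
  ⟨.inr a.1, a.2⟩

/-- The quotient projection `V₁ ⊔ V₂ → V₁ ∪ V₂`. -/
def proj : (Σ x, B₁.Fib x) ⊕ (Σ x, B₂.Fib x) → Σ z, GluedFib G B₁ B₂ z := Sum.elim H.j₁ H.j₂

theorem j₁_mem (y : G.Y) (v : B₁.Fib y.1) : H.j₁ ⟨y.1, v⟩ = ⟨.inr (G.f y), H.map y v⟩ :=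
  dif_pos y.2

theorem j₁_notMem {x : X₁} (hx : x ∉ G.Y) (v : B₁.Fib x) : H.j₁ ⟨x, v⟩ = ⟨.inl x hx, v⟩ :=
  dif_neg hx

theorem j₁_fst (a : Σ x, B₁.Fib x) : (H.j₁ a).1 = G.i₁ a.1 := by
  obtain ⟨x, v⟩ := a
  by_cases hx : x ∈ G.Y
  · rw [H.j₁_mem ⟨x, hx⟩ v]
    exact (G.i₁_mem ⟨x, hx⟩).symm
  · rw [H.j₁_notMem hx v, G.i₁_notMem hx]

theorem j₁_injective : Function.Injective H.j₁ := by
  rintro ⟨x, v⟩ ⟨x', v'⟩ h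
  have hxx : x = x' := G.i₁_injective (by
    have := congrArg Sigma.fst h
    rwa [H.j₁_fst, H.j₁_fst] at this)
  subst hxx
  by_cases hx : x ∈ G.Y
  · rw [H.j₁_mem ⟨x, hx⟩ v, H.j₁_mem ⟨x, hx⟩ v'] at h
    have := (H.map ⟨x, hx⟩).injective (eq_of_heq (Sigma.mk.inj h).2)
    rw [this]
  · rw [H.j₁_notMem hx, H.j₁_notMem hx] at h
    rw [eq_of_heq (Sigma.mk.inj h).2]

theorem proj_surjective : Function.Surjective H.proj := by
  rintro ⟨x | x, v⟩
  · exact ⟨.inl ⟨x, v⟩, H.j₁_notMem _ v⟩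
  · exact ⟨.inr ⟨x, v⟩, rfl⟩

/-- The quotient diffeology on the total space of the glued pseudo-bundle. -/
@[reducible] def totalDiffeology : DiffeologicalSpace (Σ z, GluedFib G B₁ B₂ z) :=
  pushforward H.proj

theorem isPlot_j₁ {n : ℕ} {p : E n → Σ x, B₁.Fib x} (hp : IsPlot p) :
    @IsPlot _ H.totalDiffeology n (H.j₁ ∘ p) :=
  dSmooth_pushforward H.proj n _ (Gluing.isPlot_inl hp)

theorem isPlot_j₂ {n : ℕ} {p : E n → Σ x, B₂.Fib x} (hp : IsPlot p) :
    @IsPlot _ H.totalDiffeology n (H.j₂ ∘ p) :=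
  dSmooth_pushforward H.proj n _ (Gluing.isPlot_inr hp)

/-- Locally, a plot of the glued total space lifts to one of the two total spaces. -/
theorem exists_local_lift {n : ℕ} {q : E n → Σ z, GluedFib G B₁ B₂ z}
    (hq : @IsPlot _ H.totalDiffeology n q) (x : E n) :
    ∃ s : Set (E n), IsOpen s ∧ x ∈ s ∧ ∀ m (g : E m → E n), (∀ y, g y ∈ s) → ContDiff ℝ ∞ g →
      (∃ p : E m → Σ x, B₁.Fib x, IsPlot p ∧ q ∘ g = H.j₁ ∘ p) ∨
      ∃ p : E m → Σ x, B₂.Fib x, IsPlot p ∧ q ∘ g = H.j₂ ∘ p := by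
  let d : DiffeologicalSpace (Σ z, GluedFib G B₁ B₂ z) := ofLocal
    (fun n => {q | (∃ p : E n → Σ x, B₁.Fib x, IsPlot p ∧ q = H.j₁ ∘ p) ∨
      ∃ p : E n → Σ x, B₂.Fib x, IsPlot p ∧ q = H.j₂ ∘ p})
    (by
      intro n c
      obtain ⟨a | a, rfl⟩ := H.proj_surjective c
      · exact Or.inl ⟨fun _ => a, isPlot_const, rfl⟩
      · exact Or.inr ⟨fun _ => a, isPlot_const, rfl⟩)
    (by
      rintro n m _ g (⟨p, hp, rfl⟩ | ⟨p, hp, rfl⟩) hg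
      · exact Or.inl ⟨p ∘ g, isPlot_reparam hp hg, rfl⟩
      · exact Or.inr ⟨p ∘ g, isPlot_reparam hp hg, rfl⟩)
  have hd : H.totalDiffeology ≤ d := (pushforward_le_iff _ d).mpr fun n p hp y => by
    obtain ⟨s, hs, hy, hl⟩ := hp y
    refine ⟨s, hs, hy, fun m g hg hgs => ?_⟩
    rcases hl m g hg hgs with ⟨p', hp', he⟩ | ⟨p', hp', he⟩
    · refine Or.inl ⟨p', hp', ?_⟩
      rw [Function.comp_assoc, he]
      rfl
    · refine Or.inr ⟨p', hp', ?_⟩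
      rw [Function.comp_assoc, he]
      rfl
  exact DiffeologicalSpace.le_iff'.mp hd n q hq x

/-- A plot of `V₁` over the domain of gluing gives a plot of `V₂`. -/
theorem exists_lift₂ {m : ℕ} {p : E m → Σ x, B₁.Fib x} (hp : IsPlot p)
    (h : ∀ r, (p r).1 ∈ G.Y) : ∃ q : E m → Σ x, B₂.Fib x, IsPlot q ∧ H.j₁ ∘ p = H.j₂ ∘ q :=
  ⟨_, (H.plotOver_iff m (fun r => ⟨(p r).1, h r⟩) (fun r => (p r).2)).mpr hp,
    funext fun r => H.j₁_mem ⟨(p r).1, h r⟩ (p r).2⟩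

/-- A plot of `V₂` over the image of a family of points of `X₁` gives a plot of `V₁`. -/
theorem exists_lift₁ {m : ℕ} {q : E m → Σ x, B₂.Fib x} (hq : IsPlot q) (b : E m → X₁)
    (h : ∀ r, G.i₁ (b r) = .inr (q r).1) :
    ∃ p : E m → Σ x, B₁.Fib x, IsPlot p ∧ H.j₂ ∘ q = H.j₁ ∘ p := by
  have h1 : ∀ r, ∃ (y : G.Y) (v : B₁.Fib y.1), q r = ⟨G.f y, H.map y v⟩ := by
    intro r
    obtain ⟨hy, e⟩ := G.i₁_eq_inr (h r)
    revert e
    obtain ⟨z, w⟩ := q r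
    rintro rfl
    exact ⟨⟨b r, hy⟩, (H.map _).symm w, by rw [LinearEquiv.apply_symm_apply]⟩
  choose y v hyv using h1
  refine ⟨fun r => ⟨(y r).1, v r⟩, (H.plotOver_iff m y v).mp ?_, funext fun r => ?_⟩
  · rwa [show q = fun r => ⟨G.f (y r), H.map (y r) (v r)⟩ from funext hyv] at hq
  · simp only [Function.comp_apply]
    rw [hyv r, H.j₁_mem (y r) (v r)]
    rfl

theorem j₁_add {z : Glued G} {v w : GluedFib G B₁ B₂ z} {x : X₁} {a b : B₁.Fib x}
    (ha : ⟨z, v⟩ = H.j₁ ⟨x, a⟩) (hb : ⟨z, w⟩ = H.j₁ ⟨x, b⟩) :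
    ⟨z, v + w⟩ = H.j₁ ⟨x, a + b⟩ := by
  by_cases hx : x ∈ G.Y
  · rw [H.j₁_mem ⟨x, hx⟩] at ha hb ⊢
    obtain ⟨rfl, ha⟩ := Sigma.mk.inj ha
    rw [eq_of_heq ha, eq_of_heq (Sigma.mk.inj hb).2, map_add]
  · rw [H.j₁_notMem hx] at ha hb ⊢
    obtain ⟨rfl, ha⟩ := Sigma.mk.inj ha
    rw [eq_of_heq ha, eq_of_heq (Sigma.mk.inj hb).2]

theorem j₂_add {z : Glued G} {v w : GluedFib G B₁ B₂ z} {x : X₂} {a b : B₂.Fib x}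
    (ha : ⟨z, v⟩ = H.j₂ ⟨x, a⟩) (hb : ⟨z, w⟩ = H.j₂ ⟨x, b⟩) :
    ⟨z, v + w⟩ = H.j₂ ⟨x, a + b⟩ := by
  obtain ⟨rfl, ha⟩ := Sigma.mk.inj ha
  rw [eq_of_heq ha, eq_of_heq (Sigma.mk.inj hb).2]
  rfl

theorem j₁_smul {z : Glued G} {v : GluedFib G B₁ B₂ z} {x : X₁} {a : B₁.Fib x} (c : ℝ)
    (ha : ⟨z, v⟩ = H.j₁ ⟨x, a⟩) : ⟨z, c • v⟩ = H.j₁ ⟨x, c • a⟩ := by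
  by_cases hx : x ∈ G.Y
  · rw [H.j₁_mem ⟨x, hx⟩] at ha ⊢
    obtain ⟨rfl, ha⟩ := Sigma.mk.inj ha
    rw [eq_of_heq ha, map_smul]
  · rw [H.j₁_notMem hx] at ha ⊢
    obtain ⟨rfl, ha⟩ := Sigma.mk.inj ha
    rw [eq_of_heq ha]

theorem j₂_smul {z : Glued G} {v : GluedFib G B₁ B₂ z} {x : X₂} {a : B₂.Fib x} (c : ℝ)
    (ha : ⟨z, v⟩ = H.j₂ ⟨x, a⟩) : ⟨z, c • v⟩ = H.j₂ ⟨x, c • a⟩ := by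
  obtain ⟨rfl, ha⟩ := Sigma.mk.inj ha
  rw [eq_of_heq ha]
  rfl

theorem exists_common_base {A : Type*} {Z : Type*} {F : Z → Type*} (p q : A → Σ z, F z)
    (h : ∀ r, (p r).1 = (q r).1) : ∃ (c : A → Z) (v w : ∀ r, F (c r)),
      p = (fun r => ⟨c r, v r⟩) ∧ q = (fun r => ⟨c r, w r⟩) := by
  have h1 : ∀ r, ∃ w : F (p r).1, q r = ⟨(p r).1, w⟩ := by
    intro r
    rw [h r]
    exact ⟨(q r).2, rfl⟩
  choose w hw using h1
  exact ⟨fun r => (p r).1, fun r => (p r).2, w, rfl, funext hw⟩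

theorem isPlot_add₂ {m : ℕ} {b : E m → Glued G} {v w : ∀ r, GluedFib G B₁ B₂ (b r)}
    {p q : E m → Σ x, B₂.Fib x} (hp : IsPlot p) (hq : IsPlot q)
    (hv : (fun r => (⟨b r, v r⟩ : Σ z, GluedFib G B₁ B₂ z)) = H.j₂ ∘ p)
    (hw : (fun r => (⟨b r, w r⟩ : Σ z, GluedFib G B₁ B₂ z)) = H.j₂ ∘ q) :
    @IsPlot _ H.totalDiffeology m (fun r => ⟨b r, v r + w r⟩) := by
  have hb : ∀ r, (p r).1 = (q r).1 := fun r => by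
    have h1 := congrArg Sigma.fst (congrFun hv r)
    have h2 := congrArg Sigma.fst (congrFun hw r)
    exact Glued.inr.inj (h1.symm.trans h2)
  obtain ⟨c, v', w', rfl, rfl⟩ := exists_common_base p q hb
  have := H.isPlot_j₂ (B₂.smooth_add m c v' w' hp hq)
  convert this using 1
  exact funext fun r => H.j₂_add (congrFun hv r) (congrFun hw r)

theorem isPlot_add₁ {m : ℕ} {b : E m → Glued G} {v w : ∀ r, GluedFib G B₁ B₂ (b r)}
    {p q : E m → Σ x, B₁.Fib x} (hp : IsPlot p) (hq : IsPlot q)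
    (hv : (fun r => (⟨b r, v r⟩ : Σ z, GluedFib G B₁ B₂ z)) = H.j₁ ∘ p)
    (hw : (fun r => (⟨b r, w r⟩ : Σ z, GluedFib G B₁ B₂ z)) = H.j₁ ∘ q) :
    @IsPlot _ H.totalDiffeology m (fun r => ⟨b r, v r + w r⟩) := by
  have hb : ∀ r, (p r).1 = (q r).1 := fun r => by
    have h1 := congrArg Sigma.fst (congrFun hv r)
    have h2 := congrArg Sigma.fst (congrFun hw r)
    have h3 := h1.symm.trans h2
    rw [Function.comp_apply, Function.comp_apply, H.j₁_fst, H.j₁_fst] at h3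
    exact G.i₁_injective h3
  obtain ⟨c, v', w', rfl, rfl⟩ := exists_common_base p q hb
  have := H.isPlot_j₁ (B₁.smooth_add m c v' w' hp hq)
  convert this using 1
  exact funext fun r => H.j₁_add (congrFun hv r) (congrFun hw r)

theorem mem_Y_of_eq {m : ℕ} {b : E m → Glued G} {v w : ∀ r, GluedFib G B₁ B₂ (b r)}
    {p : E m → Σ x, B₁.Fib x} {q : E m → Σ x, B₂.Fib x}
    (hv : (fun r => (⟨b r, v r⟩ : Σ z, GluedFib G B₁ B₂ z)) = H.j₁ ∘ p)
    (hw : (fun r => (⟨b r, w r⟩ : Σ z, GluedFib G B₁ B₂ z)) = H.j₂ ∘ q) (r : E m) :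
    (p r).1 ∈ G.Y := by
  have h1 := congrArg Sigma.fst (congrFun hv r)
  have h2 := congrArg Sigma.fst (congrFun hw r)
  have h3 := h1.symm.trans h2
  rw [Function.comp_apply, H.j₁_fst] at h3
  exact (G.i₁_eq_inr h3).1

/-- The glued pseudo-bundle `V₁ ∪ V₂ → X₁ ∪_f X₂`. -/
@[reducible] def glued : PseudoBundle.{max u₁ u₂, v} (Glued G) where
  Fib := GluedFib G B₁ B₂
  diffeology := H.totalDiffeology
  smooth_proj := by
    intro n q hq
    refine isPlot_of_local fun x => ?_
    obtain ⟨s, hs, hx, hl⟩ := H.exists_local_lift hq x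
    refine ⟨s, hs, hx, fun m g hg hgs => ?_⟩
    rw [Function.comp_assoc]
    rcases hl m g hg hgs with ⟨p, hp, he⟩ | ⟨p, hp, he⟩
    · rw [he]
      convert G.smooth_i₁ m _ (B₁.smooth_proj m p hp) using 1
      exact funext fun r => H.j₁_fst (p r)
    · rw [he]
      exact G.smooth_i₂ m _ (B₂.smooth_proj m p hp)
  smooth_add n b v w hv hw := by
    let _ := H.totalDiffeology
    refine isPlot_of_local fun x => ?_
    obtain ⟨s, hs, hx, hl⟩ := H.exists_local_lift hv x
    obtain ⟨s', hs', hx', hl'⟩ := H.exists_local_lift hw x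
    refine ⟨s ∩ s', hs.inter hs', ⟨hx, hx'⟩, fun m g hg hgs => ?_⟩
    rcases hl m g (fun y => (hg y).1) hgs with ⟨p, hp, he⟩ | ⟨p, hp, he⟩ <;>
    rcases hl' m g (fun y => (hg y).2) hgs with ⟨p', hp', he'⟩ | ⟨p', hp', he'⟩
    · exact H.isPlot_add₁ hp hp' he he'
    · obtain ⟨q, hq, hpq⟩ := H.exists_lift₂ hp (H.mem_Y_of_eq he he')
      exact H.isPlot_add₂ hq hp' (he.trans hpq) he'
    · obtain ⟨q, hq, hpq⟩ := H.exists_lift₂ hp' (H.mem_Y_of_eq he' he)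
      exact H.isPlot_add₂ hp hq he (he'.trans hpq)
    · exact H.isPlot_add₂ hp hp' he he'
  smooth_smul n b c v hc hv := by
    let _ := H.totalDiffeology
    refine isPlot_of_local fun x => ?_
    obtain ⟨s, hs, hx, hl⟩ := H.exists_local_lift hv x
    refine ⟨s, hs, hx, fun m g hg hgs => ?_⟩
    rcases hl m g hg hgs with ⟨p, hp, he⟩ | ⟨p, hp, he⟩
    · have := H.isPlot_j₁ (B₁.smooth_smul m _ (c ∘ g) (fun r => (p r).2) (hc.comp hgs) hp)
      convert this using 1
      exact funext fun r => H.j₁_smul (c (g r)) (congrFun he r)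
    · have := H.isPlot_j₂ (B₂.smooth_smul m _ (c ∘ g) (fun r => (p r).2) (hc.comp hgs) hp)
      convert this using 1
      exact funext fun r => H.j₂_smul (c (g r)) (congrFun he r)
  smooth_zero n b hb := by
    let _ := H.totalDiffeology
    refine isPlot_of_local fun x => ?_
    obtain ⟨s, hs, hx, hl⟩ := (isPlot_pushforward_iff G.proj_surjective).mp hb x
    refine ⟨s, hs, hx, fun m g hg hgs => ?_⟩
    obtain ⟨p, hp, he⟩ := hl m g hg hgs
    refine isPlot_of_local fun y => ?_
    obtain ⟨s', hs', hy, hl'⟩ := hp y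
    refine ⟨s', hs', hy, fun k g' hg' hgs' => ?_⟩
    rcases hl' k g' hg' hgs' with ⟨p', hp', he'⟩ | ⟨p', hp', he'⟩
    · convert H.isPlot_j₁ (B₁.smooth_zero k p' hp') using 1
      refine funext fun r => ?_
      have h1 : b (g (g' r)) = G.i₁ (p' r) :=
        (congrFun he (g' r)).trans (congrArg G.proj (congrFun he' r))
      simp only [Function.comp_apply]
      rw [h1]
      by_cases hY : p' r ∈ G.Y
      · rw [H.j₁_mem ⟨p' r, hY⟩, map_zero, G.i₁_mem ⟨p' r, hY⟩]
      · rw [H.j₁_notMem hY, G.i₁_notMem hY]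
    · convert H.isPlot_j₂ (B₂.smooth_zero k p' hp') using 1
      refine funext fun r => ?_
      have h1 : b (g (g' r)) = G.i₂ (p' r) :=
        (congrFun he (g' r)).trans (congrArg G.proj (congrFun he' r))
      simp only [Function.comp_apply]
      rw [h1]
      rfl

open Classical in
/-- The first component `s₁` of the presentation of a section of the glued pseudo-bundle
as `s = s₁ ∪ s₂`. -/
def fst (s : Sec H.glued) : Sec B₁ :=
  Sec.mk (fun x => if h : x ∈ G.Y then (H.map ⟨x, h⟩).symm (s (.inr (G.f ⟨x, h⟩)))
      else s (.inl x h)) (by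
    have key : ∀ x, H.j₁ ⟨x, if h : x ∈ G.Y then (H.map ⟨x, h⟩).symm (s (.inr (G.f ⟨x, h⟩)))
        else s (.inl x h)⟩ = ⟨G.i₁ x, s (G.i₁ x)⟩ := by
      intro x
      by_cases hx : x ∈ G.Y
      · rw [H.j₁_mem ⟨x, hx⟩, G.i₁_mem ⟨x, hx⟩, dif_pos hx, LinearEquiv.apply_symm_apply]
      · rw [H.j₁_notMem hx, G.i₁_notMem hx, dif_neg hx]
    intro n p hp
    refine isPlot_of_local fun x => ?_
    obtain ⟨t, ht, hx, hl⟩ := H.exists_local_lift (s.plotOver (G.smooth_i₁ n p hp)) x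
    refine ⟨t, ht, hx, fun m g hg hgs => ?_⟩
    have h1 : ∃ q : E m → Σ x, B₁.Fib x, IsPlot q ∧
        (fun r => (⟨G.i₁ (p (g r)), s (G.i₁ (p (g r)))⟩ : Σ z, GluedFib G B₁ B₂ z)) =
          H.j₁ ∘ q := by
      rcases hl m g hg hgs with ⟨q, hq, he⟩ | ⟨q, hq, he⟩
      · exact ⟨q, hq, he⟩
      · obtain ⟨q', hq', he'⟩ := H.exists_lift₁ hq (fun r => p (g r))
          (fun r => congrArg Sigma.fst (congrFun he r))
        exact ⟨q', hq', Eq.trans he he'⟩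
    obtain ⟨q, hq, he⟩ := h1
    convert hq using 1
    refine funext fun r => H.j₁_injective ?_
    exact (key (p (g r))).trans (congrFun he r))

/-- The second component `s₂` of the presentation of a section of the glued pseudo-bundle
as `s = s₁ ∪ s₂`. -/
def snd (s : Sec H.glued) : Sec B₂ :=
  Sec.mk (fun x => s (.inr x)) (by
    intro n p hp
    refine isPlot_of_local fun x => ?_
    obtain ⟨t, ht, hx, hl⟩ := H.exists_local_lift (s.plotOver (G.smooth_i₂ n p hp)) x
    refine ⟨t, ht, hx, fun m g hg hgs => ?_⟩
    have h1 : ∃ q : E m → Σ x, B₂.Fib x, IsPlot q ∧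
        (fun r => (⟨.inr (p (g r)), s (.inr (p (g r)))⟩ : Σ z, GluedFib G B₁ B₂ z)) =
          H.j₂ ∘ q := by
      rcases hl m g hg hgs with ⟨q, hq, he⟩ | ⟨q, hq, he⟩
      · have hY : ∀ r, (q r).1 ∈ G.Y := fun r => by
          have h2 := congrArg Sigma.fst (congrFun he r)
          exact (G.i₁_eq_inr ((H.j₁_fst (q r)).symm.trans h2.symm)).1
        obtain ⟨q', hq', he'⟩ := H.exists_lift₂ hq hY
        exact ⟨q', hq', Eq.trans he he'⟩
      · exact ⟨q, hq, he⟩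
    obtain ⟨q, hq, he⟩ := h1
    convert hq using 1
    refine funext fun r => ?_
    have h2 := congrFun he r
    have h3 : H.j₂ ⟨p (g r), s (.inr (p (g r)))⟩ = H.j₂ (q r) := h2
    revert h3
    obtain ⟨z, w⟩ := q r
    intro h3
    obtain ⟨h4, h5⟩ := Sigma.mk.inj h3
    obtain rfl := Glued.inr.inj h4
    exact congrArg (Sigma.mk _) (eq_of_heq h5))

end BundleGluing

end Gluing

/-! ### Compatibility, and the induced connection and pseudo-metric -/

section Induced

variable {X₁ : Type u₁} {X₂ : Type u₂} [DiffeologicalSpace X₁] [DiffeologicalSpace X₂]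
  {G : Gluing X₁ X₂} {B₁ : PseudoBundle.{u₁, v} X₁} {B₂ : PseudoBundle.{u₂, v} X₂}

namespace BundleGluing

variable (H : BundleGluing G B₁ B₂)

/-- Two sections are compatible when the gluing map takes the first one to the second one. -/
def SectionsCompatible (s₁ : Sec B₁) (s₂ : Sec B₂) : Prop :=
  ∀ y : G.Y, H.map y (s₁ y.1) = s₂ (G.f y)

/-- Two connections are compatible when `(i^* ⊗ f̃)(∇¹s₁(y)) = (f^*j^* ⊗ Id)(∇²s₂(f(y)))` for all
compatible sections `s₁`, `s₂` and all `y ∈ Y`. -/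
def ConnectionsCompatible (C₁ : Connection B₁) (C₂ : Connection B₂) : Prop :=
  ∀ (s₁ : Sec B₁) (s₂ : Sec B₂), H.SectionsCompatible s₁ s₂ → ∀ y : G.Y,
    TensorProduct.map (G.pullΛ₁ y) (H.map y).toLinearMap (C₁.toLin s₁ y.1) =
      TensorProduct.map (G.pullΛ₂ y) LinearMap.id (C₂.toLin s₂ (G.f y))

/-- Two pseudo-metrics are compatible when the gluing map is an isometry. -/
def MetricsCompatible (g₁ : ∀ x, LinearMap.BilinForm ℝ (B₁.Fib x))
    (g₂ : ∀ x, LinearMap.BilinForm ℝ (B₂.Fib x)) : Prop :=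
  ∀ (y : G.Y) (v w : B₁.Fib y.1), g₁ y.1 v w = g₂ (G.f y) (H.map y v) (H.map y w)

/-- The induced pseudo-metric on the glued pseudo-bundle. -/
def inducedMetric (g₁ : ∀ x, LinearMap.BilinForm ℝ (B₁.Fib x))
    (g₂ : ∀ x, LinearMap.BilinForm ℝ (B₂.Fib x)) :
    ∀ z, LinearMap.BilinForm ℝ (H.glued.Fib z)
  | .inl x _ => g₁ x
  | .inr x => g₂ x

/-- The map `(ρ̃₁ ⊕ ρ̃₂) ⊗ Id` over the class of `y ∈ Y`. -/
def restrictBoth (_H : BundleGluing G B₁ B₂) (y : G.Y) : CotangentAt (Glued.inr (G.f y) : Glued G) ⊗[ℝ] B₂.Fib (G.f y) →ₗ[ℝ]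
    (CotangentAt y.1 × CotangentAt (G.f y)) ⊗[ℝ] B₂.Fib (G.f y) :=
  TensorProduct.map ((G.ρ₁ (G.i₁_mem y)).prod (G.ρ₂ (G.f y))) LinearMap.id

/-- The element `(Incl ⊗ f̃)(∇¹s₁(y)) + (Incl ⊗ Id)(∇²s₂(f(y)))`, where `s = s₁ ∪ s₂`. -/
def inclSum (C₁ : Connection B₁) (C₂ : Connection B₂) (s : Sec H.glued) (y : G.Y) :
    (CotangentAt y.1 × CotangentAt (G.f y)) ⊗[ℝ] B₂.Fib (G.f y) :=
  TensorProduct.map (LinearMap.inl ℝ (CotangentAt y.1) (CotangentAt (G.f y)))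
      (H.map y).toLinearMap (C₁.toLin (H.fst s) y.1) +
    TensorProduct.map (LinearMap.inr ℝ (CotangentAt y.1) (CotangentAt (G.f y)))
      LinearMap.id (C₂.toLin (H.snd s) (G.f y))

/-- The formula for `∇^∪` makes sense over the domain of gluing: the elements to which the inverse
of `(ρ̃₁ ⊕ ρ̃₂) ⊗ Id` is to be applied lie in the range of this map. -/
def InducedWellDefined (C₁ : Connection B₁) (C₂ : Connection B₂) : Prop :=
  ∀ (s : Sec H.glued) (y : G.Y),
    H.inclSum C₁ C₂ s y ∈ LinearMap.range (H.restrictBoth y)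

open Classical in
/-- The induced operator `∇^∪`. -/
def inducedConnection (C₁ : Connection B₁) (C₂ : Connection B₂) (s : Sec H.glued) :
    ∀ z : Glued G, CotangentAt z ⊗[ℝ] H.glued.Fib z
  | .inl x hx => Function.invFun
      (TensorProduct.map (G.ρ₁ (G.i₁_notMem hx)) (LinearMap.id : B₁.Fib x →ₗ[ℝ] B₁.Fib x))
      (C₁.toLin (H.fst s) x)
  | .inr x =>
    if h : ∃ y, G.f y = x then
      h.choose_spec ▸ Function.invFun (H.restrictBoth h.choose) (H.inclSum C₁ C₂ s h.choose)
    else Function.invFun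
      (TensorProduct.map (G.ρ₂ x) (LinearMap.id : B₂.Fib x →ₗ[ℝ] B₂.Fib x))
      (C₂.toLin (H.snd s) x)

/-- The three identities by which the operator `N` is the one induced by the two connections; the
inverses in the definition of the induced operator are thus genuine values. -/
structure IsInduced (C₁ : Connection B₁) (C₂ : Connection B₂)
    (N : Sec H.glued → ∀ z, CotangentAt z ⊗[ℝ] H.glued.Fib z) : Prop where
  left : ∀ s (x : X₁) (hx : x ∉ G.Y),
    TensorProduct.map (G.ρ₁ (G.i₁_notMem hx)) (LinearMap.id : B₁.Fib x →ₗ[ℝ] B₁.Fib x)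
      (N s (.inl x hx)) = C₁.toLin (H.fst s) x
  right : ∀ s (x : X₂), (∀ y, G.f y ≠ x) →
    TensorProduct.map (G.ρ₂ x) (LinearMap.id : B₂.Fib x →ₗ[ℝ] B₂.Fib x)
      (N s (.inr x)) = C₂.toLin (H.snd s) x
  both : ∀ s (y : G.Y), H.restrictBoth y (N s (.inr (G.f y))) = H.inclSum C₁ C₂ s y

end BundleGluing

end Induced

end DiffGluing

end

/-!
All that is asserted about the glued space `X₁ ∪_f X₂` reduces to statements about `X₁` and `X₂`
because its plots lift, locally, to plots of one of these two spaces (`Gluing.exists_lift`). Local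
lifts are described by maps `c` that are the identity near a given point and take all their values
in a prescribed neighbourhood of it: composition with `c` changes neither the germ of a plot at
the point nor the value of a form there.

*The inverses exist.* If the two pushforward diffeologies on `Ω¹(Y)` agree, then the restrictions
`Ω¹(X₁) → Ω¹(Y)` and `Ω¹(X₂) → Ω¹(Y)` have the same range, as seen on the plots `t ↦ t • θ`
(`exists_eq_of_pushforward_eq`). Hence every form on `X₁` has a partner on `X₂` with the same
restriction to `Y`, and conversely. Two such forms glue (`Gluing.glueForms`): the value of the glued
form on a plot is computed on a local lift, and any two lifts give the same value, the case of lifts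
to different summands being the one where the agreement over `Y` enters. So the restrictions
`ρ̃₁`, `ρ̃₂` of values of forms are surjective, and they remain so after tensoring with a
fibre; over `Y`, membership in the range is a hypothesis.

*Compatibility with the metric.* An element of `Λ¹_z(X₁ ∪_f X₂)` is determined by its restrictions
at the representatives of `z` in `X₁` and in `X₂` (`Gluing.cotangent_ext`), again by local
lifting. The function `g̃(s, t)` restricts to `g₁(s₁, t₁)` and `g₂(s₂, t₂)`, contraction with
a functional is natural (`contraction_map`), and the restrictions of `∇^∪ s` are `∇¹s₁` and `∇²s₂`,
the former up to `f̃` over `Y`, where `f̃` is an isometry. The identity for `g̃` thus follows from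
the identities for `g₁` and `g₂` (`BundleGluing.IsInduced.metricCompatible`).
-/

namespace DiffGluing

/-! ### Localization of plots and forms -/

section Localization

/-- An open set around `x` contains the image of a smooth map which is the identity near `x`. -/
theorem exists_contDiff_eventuallyEq_id {n : ℕ} {u : Set (E n)} (hu : IsOpen u) {x : E n}
    (hx : x ∈ u) : ∃ c : E n → E n, ContDiff ℝ ∞ c ∧ (∀ y, c y ∈ u) ∧ c =ᶠ[nhds x] id := by
  obtain ⟨ε, hε, hb⟩ := Metric.isOpen_iff.mp hu x hx
  let f : ContDiffBump x := ⟨ε / 2, ε, half_pos hε, half_lt_self hε⟩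
  refine ⟨fun y => x + f y • (y - x), ?_, fun y => hb ?_, ?_⟩
  · exact contDiff_const.add (f.contDiff.smul (contDiff_id.sub contDiff_const))
  · rw [mem_ball_iff_norm, add_sub_cancel_left, norm_smul, Real.norm_of_nonneg f.nonneg]
    by_cases hy : y ∈ Metric.ball x ε
    · calc f y * ‖y - x‖ ≤ 1 * ‖y - x‖ := by gcongr; exact f.le_one
        _ < ε := by rw [one_mul]; exact mem_ball_iff_norm.mp hy
    · rw [f.zero_of_le_dist (not_lt.mp hy), zero_mul]
      exact hε
  · filter_upwards [f.eventuallyEq_one] with y hy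
    simp [hy]

variable {X : Type*} [DiffeologicalSpace X]

theorem Form.ext {θ η : Form X} (h : ∀ (n : ℕ) (p : E n → X) (hp : IsPlot p) (r : E n),
    θ.eval p hp r = η.eval p hp r) : θ = η :=
  Subtype.ext (funext fun n => funext fun p => funext fun r => h n p.1 p.2 r)

theorem Form.eval_congr (θ : Form X) {n : ℕ} {p q : E n → X} (h : p = q) (hp : IsPlot p)
    (hq : IsPlot q) (r : E n) : θ.eval p hp r = θ.eval q hq r := by
  subst h; rfl

theorem Form.eval_comp (θ : Form X) {n m : ℕ} {p : E n → X} (hp : IsPlot p) {g : E m → E n}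
    (hg : ContDiff ℝ ∞ g) (r : E m) :
    θ.eval (p ∘ g) (isPlot_reparam hp hg) r = (θ.eval p hp (g r)).comp (fderiv ℝ g r) :=
  θ.isForm.comp n m ⟨p, hp⟩ g hg r

theorem Form.eval_comp_of_eventuallyEq_id (θ : Form X) {n : ℕ} {p : E n → X} (hp : IsPlot p)
    {c : E n → E n} (hc : ContDiff ℝ ∞ c) {x : E n} (hcx : c =ᶠ[nhds x] id) :
    θ.eval (p ∘ c) (isPlot_reparam hp hc) x = θ.eval p hp x := by
  rw [θ.eval_comp hp hc, hcx.fderiv_eq, hcx.eq_of_nhds, fderiv_id, id,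
    ContinuousLinearMap.comp_id]

/-- The values of two forms on two local lifts of a map `q` agree, as soon as the forms take the
same values on any two plots with the same image in the target of `q`. The first lift is one of
`q ∘ c` for a map `c` which is the identity near `r`, the second one is one of `q ∘ g`
with `g y = r`. -/
theorem Form.eval_comp_fderiv_of_lift {X' Z : Type*} [DiffeologicalSpace X'] {a : X → Z}
    {a' : X' → Z} {θ : Form X} {θ' : Form X'}
    (h : ∀ (k : ℕ) (p : E k → X) (p' : E k → X') (hp : IsPlot p) (hp' : IsPlot p'),
      a ∘ p = a' ∘ p' → ∀ r, θ.eval p hp r = θ'.eval p' hp' r)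
    {n m : ℕ} {q : E n → Z} {r : E n} {c : E n → E n} (hcr : c =ᶠ[nhds r] id)
    {p : E n → X} (hp : IsPlot p) (hqc : q ∘ c = a ∘ p)
    {g : E m → E n} (hg : ContDiff ℝ ∞ g) {y : E m} (hy : g y = r)
    {p' : E m → X'} (hp' : IsPlot p') (hqg : q ∘ g = a' ∘ p') :
    (θ.eval p hp r).comp (fderiv ℝ g y) = θ'.eval p' hp' y := by
  obtain ⟨w, hwc, hw, hrw⟩ := eventually_nhds_iff.mp hcr
  -- A cut-off `d` near `y` keeps `g ∘ d` in the region where `c` is the identity.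
  obtain ⟨d, hd, hdw, hdy⟩ := exists_contDiff_eventuallyEq_id (hw.preimage hg.continuous)
    (x := y) (by rwa [Set.mem_preimage, hy])
  have h1 : a ∘ (p ∘ (g ∘ d)) = a' ∘ (p' ∘ d) := by
    rw [← Function.comp_assoc, ← Function.comp_assoc a', ← hqc, ← hqg]
    exact funext fun z => congrArg q (hwc _ (hdw z))
  have h2 := h m _ _ (isPlot_reparam hp (hg.comp hd)) (isPlot_reparam hp' hd) h1 y
  rw [θ'.eval_comp_of_eventuallyEq_id hp' hd hdy, θ.eval_comp hp (hg.comp hd)] at h2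
  have h3 : g ∘ d =ᶠ[nhds y] g := by
    filter_upwards [hdy] with z hz
    rw [Function.comp_apply, hz, id]
  rwa [h3.fderiv_eq, h3.eq_of_nhds, hy] at h2

end Localization

/-! ### Ranges of maps with equal pushforward diffeologies -/

section Ranges

variable {A B C : Type*} [DiffeologicalSpace A] [DiffeologicalSpace B] [DiffeologicalSpace C]

/-- If two linear maps push the functional diffeologies forward to the same diffeology, then they
have the same range: the plot `t ↦ t • P θ` lifts along `Q` near `0`, unless it is constant
there. -/
theorem exists_eq_of_pushforward_eq (P : Form A →ₗ[ℝ] Form C) (Q : Form B →ₗ[ℝ] Form C)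
    (h : pushforward P = pushforward Q) (θ : Form A) : ∃ η, Q η = P θ := by
  have hφ : IsPlot (fun r : E 1 => r 0 • θ) :=
    isPlot_form_smul (by fun_prop) isPlot_const
  have hq : @IsPlot _ (pushforward Q) 1 (P ∘ fun r : E 1 => r 0 • θ) := by
    rw [← h]
    exact dSmooth_pushforward P 1 _ hφ
  obtain ⟨u, hu, hx, hl⟩ := hq 0
  obtain ⟨c, hc, hcu, hc0⟩ := exists_contDiff_eventuallyEq_id hu hx
  have hcont : Filter.Tendsto (fun t : ℝ => (t • EuclideanSpace.single 0 1 : E 1))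
      (nhdsWithin 0 {0}ᶜ) (nhds 0) := by
    have h1 : Continuous fun t : ℝ => (t • EuclideanSpace.single 0 1 : E 1) := by fun_prop
    have h2 := h1.tendsto 0
    rw [show ((0 : ℝ) • EuclideanSpace.single 0 1 : E 1) = 0 by simp] at h2
    exact h2.mono_left nhdsWithin_le_nhds
  obtain ⟨t, ht, ht0⟩ := ((hcont.eventually hc0).and self_mem_nhdsWithin).exists
  have ht0 : t ≠ 0 := ht0
  rcases hl 1 c hcu hc with ⟨p, -, hp⟩ | ⟨b, hb⟩
  · have h1 := congrFun hp (t • EuclideanSpace.single 0 1)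
    simp only [Function.comp_apply, ht, id, map_smul] at h1
    refine ⟨t⁻¹ • p (t • EuclideanSpace.single 0 1), ?_⟩
    rw [map_smul, ← h1]
    simp [ht0]
  · have h1 := (congrFun hb (t • EuclideanSpace.single 0 1)).trans (congrFun hb 0).symm
    have h0 : c 0 = 0 := hc0.eq_of_nhds
    simp only [Function.comp_apply, ht, id, map_smul, h0] at h1
    have h2 : P θ = 0 := by simpa [ht0] using h1
    exact ⟨0, by rw [map_zero, h2]⟩

end Ranges

/-! ### Plots of the glued space -/

namespace Gluing

variable {X₁ : Type u₁} {X₂ : Type u₂} [DiffeologicalSpace X₁] [DiffeologicalSpace X₂]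
  (G : Gluing X₁ X₂)

theorem i₂_injective : Function.Injective G.i₂ := fun _ _ h => Glued.inr.inj h

/-- Near each point, a plot of the glued space lifts to a plot of `X₁` or of `X₂`. -/
theorem exists_lift {n : ℕ} {q : E n → Glued G} (hq : IsPlot q) (x : E n) :
    ∃ c : E n → E n, ContDiff ℝ ∞ c ∧ c =ᶠ[nhds x] id ∧
      ((∃ p : E n → X₁, IsPlot p ∧ q ∘ c = G.i₁ ∘ p) ∨
        ∃ p : E n → X₂, IsPlot p ∧ q ∘ c = G.i₂ ∘ p) := by
  obtain ⟨u, hu, hx, hl⟩ := (isPlot_pushforward_iff G.proj_surjective).mp hq x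
  obtain ⟨c, hc, hcu, hcx⟩ := exists_contDiff_eventuallyEq_id hu hx
  obtain ⟨p, hp, he⟩ := hl n c hcu hc
  obtain ⟨u', hu', hx', hl'⟩ := hp x
  obtain ⟨c', hc', hcu', hcx'⟩ := exists_contDiff_eventuallyEq_id hu' hx'
  refine ⟨c ∘ c', hc.comp hc', ?_, ?_⟩
  · have h1 : Filter.Tendsto c' (nhds x) (nhds x) := by
      have := hc'.continuous.tendsto x
      rwa [hcx'.eq_of_nhds] at this
    filter_upwards [h1.eventually hcx, hcx'] with y hy hy'
    rw [Function.comp_apply, hy, hy', id, id]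
  · rw [← Function.comp_assoc, he, Function.comp_assoc]
    rcases hl' n c' hcu' hc' with ⟨p', hp', he'⟩ | ⟨p', hp', he'⟩
    · exact Or.inl ⟨p', hp', by rw [he']; rfl⟩
    · exact Or.inr ⟨p', hp', by rw [he']; rfl⟩

theorem dSmooth_of_comp {F : Glued G → ℝ} (h₁ : DSmooth (F ∘ G.i₁)) (h₂ : DSmooth (F ∘ G.i₂)) :
    DSmooth F := by
  intro n q hq
  refine ContDiff.isPlot (contDiff_iff_contDiffAt.mpr fun x => ?_)
  obtain ⟨c, hc, hcx, hl⟩ := G.exists_lift hq x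
  have h : ContDiff ℝ ∞ (F ∘ (q ∘ c)) := by
    rcases hl with ⟨p, hp, he⟩ | ⟨p, hp, he⟩
    · rw [he]; exact (h₁ n p hp).contDiff
    · rw [he]; exact (h₂ n p hp).contDiff
  refine h.contDiffAt.congr_of_eventuallyEq ?_
  filter_upwards [hcx] with y hy
  simp only [Function.comp_apply, hy, id]

/-! ### Gluing of forms -/

/-- The linear form `L` is the value at `r` of the form glued from `ω₁` and `ω₂` on the plot `q`:
its pullbacks along smooth maps `g` with `g y = r` are the values of `ω₁` and `ω₂` on all
lifts of `q ∘ g` to `X₁` and `X₂`. -/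
structure IsGluedValue (ω₁ : Form X₁) (ω₂ : Form X₂) {n : ℕ} (q : E n → Glued G) (r : E n)
    (L : E n →L[ℝ] ℝ) : Prop where
  left : ∀ (m : ℕ) (g : E m → E n) (p : E m → X₁) (hp : IsPlot p) (y : E m),
    ContDiff ℝ ∞ g → g y = r → q ∘ g = G.i₁ ∘ p → L.comp (fderiv ℝ g y) = ω₁.eval p hp y
  right : ∀ (m : ℕ) (g : E m → E n) (p : E m → X₂) (hp : IsPlot p) (y : E m),
    ContDiff ℝ ∞ g → g y = r → q ∘ g = G.i₂ ∘ p → L.comp (fderiv ℝ g y) = ω₂.eval p hp y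

variable {G} {ω₁ : Form X₁} {ω₂ : Form X₂}

/-- A plot of the glued space that lifts both to `X₁` and to `X₂` takes its values in the image of
`Y`, so that two forms with the same pullback to `Y` agree on these lifts. -/
theorem eval_eq_of_i₁_comp_eq (h : G.pull₁ ω₁ = G.pull₂ ω₂) {k : ℕ} {p : E k → X₁}
    {p' : E k → X₂} (hp : IsPlot p) (hp' : IsPlot p') (he : G.i₁ ∘ p = G.i₂ ∘ p') (r : E k) :
    ω₁.eval p hp r = ω₂.eval p' hp' r := by
  have hY : ∀ z, ∃ hz : p z ∈ G.Y, G.f ⟨p z, hz⟩ = p' z := fun z => G.i₁_eq_inr (congrFun he z)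
  choose hz hf using hY
  -- Both plots come from a plot `b` of the domain of gluing.
  let b : E k → G.Y := fun z => ⟨p z, hz z⟩
  have hb : IsPlot b := hp
  have h1 := congrArg (fun θ : Form G.Y => θ.eval b hb r) h
  exact h1.trans (ω₂.eval_congr (funext hf) _ _ r)

theorem exists_isGluedValue (h : G.pull₁ ω₁ = G.pull₂ ω₂) {n : ℕ} {q : E n → Glued G}
    (hq : IsPlot q) (r : E n) : ∃ L, G.IsGluedValue ω₁ ω₂ q r L := by
  obtain ⟨c, -, hcr, ⟨p, hp, he⟩ | ⟨p, hp, he⟩⟩ := G.exists_lift hq r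
  · refine ⟨ω₁.eval p hp r, ⟨fun m g p' hp' y hg hy he' => ?_, fun m g p' hp' y hg hy he' => ?_⟩⟩
    · exact Form.eval_comp_fderiv_of_lift (fun k p p' hp hp' e r =>
        ω₁.eval_congr (G.i₁_injective.comp_left e) hp hp' r) hcr hp he hg hy hp' he'
    · exact Form.eval_comp_fderiv_of_lift (fun k p p' hp hp' e r =>
        eval_eq_of_i₁_comp_eq h hp hp' e r) hcr hp he hg hy hp' he'
  · refine ⟨ω₂.eval p hp r, ⟨fun m g p' hp' y hg hy he' => ?_, fun m g p' hp' y hg hy he' => ?_⟩⟩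
    · exact Form.eval_comp_fderiv_of_lift (fun k p p' hp hp' e r =>
        (eval_eq_of_i₁_comp_eq h hp' hp e.symm r).symm) hcr hp he hg hy hp' he'
    · exact Form.eval_comp_fderiv_of_lift (fun k p p' hp hp' e r =>
        ω₂.eval_congr (G.i₂_injective.comp_left e) hp hp' r) hcr hp he hg hy hp' he'

theorem IsGluedValue.unique {n : ℕ} {q : E n → Glued G} (hq : IsPlot q) {r : E n}
    {L L' : E n →L[ℝ] ℝ} (hL : G.IsGluedValue ω₁ ω₂ q r L) (hL' : G.IsGluedValue ω₁ ω₂ q r L') :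
    L = L' := by
  obtain ⟨c, hc, hcr, hl⟩ := G.exists_lift hq r
  have h : L.comp (fderiv ℝ c r) = L'.comp (fderiv ℝ c r) := by
    rcases hl with ⟨p, hp, he⟩ | ⟨p, hp, he⟩
    · exact (hL.left n c p hp r hc hcr.eq_of_nhds he).trans
        (hL'.left n c p hp r hc hcr.eq_of_nhds he).symm
    · exact (hL.right n c p hp r hc hcr.eq_of_nhds he).trans
        (hL'.right n c p hp r hc hcr.eq_of_nhds he).symm
  rwa [hcr.fderiv_eq, fderiv_id, ContinuousLinearMap.comp_id, ContinuousLinearMap.comp_id] at h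

theorem IsGluedValue.comp {n m : ℕ} {q : E n → Glued G} {g : E m → E n} (hg : ContDiff ℝ ∞ g)
    {r : E m} {L : E n →L[ℝ] ℝ} (hL : G.IsGluedValue ω₁ ω₂ q (g r) L) :
    G.IsGluedValue ω₁ ω₂ (q ∘ g) r (L.comp (fderiv ℝ g r)) := by
  have key : ∀ {k : ℕ} {d : E k → E m} {y : E k}, ContDiff ℝ ∞ d → d y = r →
      (L.comp (fderiv ℝ g r)).comp (fderiv ℝ d y) = L.comp (fderiv ℝ (g ∘ d) y) := by
    rintro k d y hd rfl
    rw [fderiv_comp y (hg.differentiable (by simp) _) (hd.differentiable (by simp) _),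
      ContinuousLinearMap.comp_assoc]
  constructor
  · intro k d p hp y hd hy he
    rw [key hd hy]
    exact hL.left k (g ∘ d) p hp y (hg.comp hd) (congrArg g hy) he
  · intro k d p hp y hd hy he
    rw [key hd hy]
    exact hL.right k (g ∘ d) p hp y (hg.comp hd) (congrArg g hy) he

theorem contDiffAt_of_isGluedValue {n : ℕ} {q : E n → Glued G} (hq : IsPlot q)
    {L : E n → (E n →L[ℝ] ℝ)} (hL : ∀ r, G.IsGluedValue ω₁ ω₂ q r (L r)) (x : E n) :
    ContDiffAt ℝ ∞ L x := by
  obtain ⟨c, hc, hcx, hl⟩ := G.exists_lift hq x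
  -- Near `x` the map `c` is the identity, so that the values of `L` are those of a form on a lift.
  have h : ∃ M : E n → (E n →L[ℝ] ℝ), ContDiff ℝ ∞ M ∧
      ∀ r, c r = r → (L r).comp (fderiv ℝ c r) = M r := by
    rcases hl with ⟨p, hp, he⟩ | ⟨p, hp, he⟩
    · exact ⟨_, ω₁.isForm.smooth n ⟨p, hp⟩, fun r hr => (hL r).left n c p hp r hc hr he⟩
    · exact ⟨_, ω₂.isForm.smooth n ⟨p, hp⟩, fun r hr => (hL r).right n c p hp r hc hr he⟩
  obtain ⟨M, hM, hLM⟩ := h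
  refine hM.contDiffAt.congr_of_eventuallyEq ?_
  filter_upwards [hcx.eventuallyEq_nhds] with r hr
  have h1 := hLM r hr.eq_of_nhds
  rwa [hr.fderiv_eq, fderiv_id, ContinuousLinearMap.comp_id] at h1

/-- The form `ω₁ ∪ ω₂` on the glued space, for two forms with the same pullback to the domain of
gluing. -/
noncomputable def glueForms (h : G.pull₁ ω₁ = G.pull₂ ω₂) : Form (Glued G) :=
  ⟨fun _ q r => (exists_isGluedValue h q.2 r).choose, IsForm.mk
    (fun _ q => contDiff_iff_contDiffAt.mpr fun x => contDiffAt_of_isGluedValue q.2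
      (fun r => (exists_isGluedValue h q.2 r).choose_spec) x)
    (fun _ _ q g hg r => IsGluedValue.unique (isPlot_reparam q.2 hg)
      (exists_isGluedValue h (isPlot_reparam q.2 hg) r).choose_spec
      ((exists_isGluedValue h q.2 (g r)).choose_spec.comp hg))⟩

theorem isGluedValue_glueForms (h : G.pull₁ ω₁ = G.pull₂ ω₂) {n : ℕ} {q : E n → Glued G}
    (hq : IsPlot q) (r : E n) : G.IsGluedValue ω₁ ω₂ q r ((glueForms h).eval q hq r) :=
  (exists_isGluedValue h hq r).choose_spec

theorem pullback_i₁_glueForms (h : G.pull₁ ω₁ = G.pull₂ ω₂) :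
    pullback G.i₁ G.smooth_i₁ (glueForms h) = ω₁ :=
  Form.ext fun n p hp r => by
    have h1 := (isGluedValue_glueForms h (G.smooth_i₁ n p hp) r).left n id p hp r contDiff_id
      rfl rfl
    rwa [fderiv_id, ContinuousLinearMap.comp_id] at h1

theorem pullback_i₂_glueForms (h : G.pull₁ ω₁ = G.pull₂ ω₂) :
    pullback G.i₂ G.smooth_i₂ (glueForms h) = ω₂ :=
  Form.ext fun n p hp r => by
    have h1 := (isGluedValue_glueForms h (G.smooth_i₂ n p hp) r).right n id p hp r contDiff_id
      rfl rfl
    rwa [fderiv_id, ContinuousLinearMap.comp_id] at h1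

/-! ### Values of forms on the glued space -/

variable (G)

theorem ρ₁_surjective (hD : G.D₁ = G.D₂) {x : X₁} {z : Glued G} (e : G.i₁ x = z) :
    Function.Surjective (G.ρ₁ e) := by
  intro α
  obtain ⟨ω₁, rfl⟩ := Submodule.mkQ_surjective _ α
  obtain ⟨ω₂, h⟩ := exists_eq_of_pushforward_eq G.pull₁ G.pull₂ hD ω₁
  exact ⟨valueAt z (glueForms h.symm), congrArg (valueAt x) (pullback_i₁_glueForms h.symm)⟩

theorem ρ₂_surjective (hD : G.D₁ = G.D₂) (x : X₂) : Function.Surjective (G.ρ₂ x) := by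
  intro α
  obtain ⟨ω₂, rfl⟩ := Submodule.mkQ_surjective _ α
  obtain ⟨ω₁, h⟩ := exists_eq_of_pushforward_eq G.pull₂ G.pull₁ hD.symm ω₂
  exact ⟨valueAt _ (glueForms h), congrArg (valueAt x) (pullback_i₂_glueForms h)⟩

/-- The value of a form at a point of the glued space is determined by its restrictions: every
plot through the point lifts, near the origin, to a plot of `X₁` or of `X₂`. -/
theorem cotangent_ext {z : Glued G} {α β : CotangentAt z}
    (h₁ : ∀ (x : X₁) (e : G.i₁ x = z), G.ρ₁ e α = G.ρ₁ e β)
    (h₂ : ∀ (x : X₂) (e : Glued.inr x = z),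
      pullbackAt G.i₂ G.smooth_i₂ e α = pullbackAt G.i₂ G.smooth_i₂ e β) : α = β := by
  rw [← sub_eq_zero]
  replace h₁ : ∀ (x : X₁) (e : G.i₁ x = z), G.ρ₁ e (α - β) = 0 := fun x e => by
    rw [map_sub, h₁ x e, sub_self]
  replace h₂ : ∀ (x : X₂) (e : Glued.inr x = z),
      pullbackAt G.i₂ G.smooth_i₂ e (α - β) = 0 := fun x e => by
    rw [map_sub, h₂ x e, sub_self]
  revert h₁ h₂
  obtain ⟨θ, hθ⟩ := Submodule.mkQ_surjective _ (α - β)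
  rw [← hθ]
  intro h₁ h₂
  refine (Submodule.Quotient.mk_eq_zero _).mpr fun n q hq hq0 => ?_
  obtain ⟨c, hc, hc0, hl⟩ := G.exists_lift hq 0
  rw [← θ.eval_comp_of_eventuallyEq_id hq hc hc0]
  have hqc : (q ∘ c) 0 = z := by rw [Function.comp_apply, hc0.eq_of_nhds, id, hq0]
  rcases hl with ⟨p, hp, he⟩ | ⟨p, hp, he⟩
  · have h := (Submodule.Quotient.mk_eq_zero _).mp (h₁ (p 0) ((congrFun he 0).symm.trans hqc))
    exact (θ.eval_congr he _ _ 0).trans (h n p hp rfl)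
  · have h := (Submodule.Quotient.mk_eq_zero _).mp (h₂ (p 0) ((congrFun he 0).symm.trans hqc))
    exact (θ.eval_congr he _ _ 0).trans (h n p hp rfl)

end Gluing

/-! ### Contractions -/

section Contraction

variable {M M' V V' : Type*} [AddCommGroup M] [Module ℝ M] [AddCommGroup M'] [Module ℝ M']
  [AddCommGroup V] [Module ℝ V] [AddCommGroup V'] [Module ℝ V']

/-- The contraction `M ⊗ V → M`, `α ⊗ v ↦ l(v) α`, with a linear functional on `V`. -/
noncomputable def contraction (M : Type*) [AddCommGroup M] [Module ℝ M] (l : Module.Dual ℝ V) :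
    M ⊗[ℝ] V →ₗ[ℝ] M :=
  (TensorProduct.rid ℝ M).toLinearMap ∘ₗ LinearMap.lTensor M l

theorem contraction_map (φ : M →ₗ[ℝ] M') (m : V →ₗ[ℝ] V') {l : Module.Dual ℝ V}
    {l' : Module.Dual ℝ V'} (h : ∀ v, l' (m v) = l v) (t : M ⊗[ℝ] V) :
    contraction M' l' (TensorProduct.map φ m t) = φ (contraction M l t) := by
  induction t using TensorProduct.induction_on with
  | zero => simp only [map_zero]
  | tmul α v => simp [contraction, h]
  | add s t hs ht => simp only [map_add, hs, ht]

end Contraction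

/-! ### The induced operator -/

namespace BundleGluing

variable {X₁ : Type u₁} {X₂ : Type u₂} [DiffeologicalSpace X₁] [DiffeologicalSpace X₂]
  {G : Gluing X₁ X₂} {B₁ : PseudoBundle.{u₁, v} X₁} {B₂ : PseudoBundle.{u₂, v} X₂}
  (H : BundleGluing G B₁ B₂)

theorem fst_of_notMem (s : Sec H.glued) {x : X₁} (hx : x ∉ G.Y) : H.fst s x = s (.inl x hx) :=
  dif_neg hx

theorem sectionsCompatible_fst_snd (s : Sec H.glued) :
    H.SectionsCompatible (H.fst s) (H.snd s) := fun y => by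
  have h : H.fst s y.1 = (H.map y).symm (s (.inr (G.f y))) := dif_pos y.2
  rw [h, LinearEquiv.apply_symm_apply]
  rfl

variable {H} {C₁ : Connection B₁} {C₂ : Connection B₂}

theorem isInduced_inducedConnection (hD : G.D₁ = G.D₂) (hwd : H.InducedWellDefined C₁ C₂) :
    H.IsInduced C₁ C₂ (H.inducedConnection C₁ C₂) where
  left s x hx := Function.invFun_eq
    (TensorProduct.map_surjective (G.ρ₁_surjective hD _) Function.surjective_id _)
  right s x hx := by
    have h : ¬ ∃ y, G.f y = x := fun ⟨y, hy⟩ => hx y hy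
    simp only [inducedConnection, dif_neg h]
    exact Function.invFun_eq
      (TensorProduct.map_surjective (G.ρ₂_surjective hD _) Function.surjective_id _)
  both s y := by
    have h : ∃ y', G.f y' = G.f y := ⟨y, rfl⟩
    simp only [inducedConnection, dif_pos h]
    -- The point chosen in the definition of the operator is `y`, since `f` is injective.
    have key : ∀ (y' : G.Y) (e : G.f y' = G.f y), H.restrictBoth y
        (e ▸ Function.invFun (H.restrictBoth y') (H.inclSum C₁ C₂ s y')) =
          H.inclSum C₁ C₂ s y := by
      intro y' e
      obtain rfl := G.injective e
      exact Function.invFun_eq (hwd s y')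
    exact key _ h.choose_spec

namespace IsInduced

variable {N : Sec H.glued → ∀ z, CotangentAt z ⊗[ℝ] H.glued.Fib z}

/-- Over the domain of gluing, the restriction of `∇^∪ s` to `X₁` is `∇¹s₁`, with the values
of sections transported by `f̃`. -/
theorem map_ρ₁_of_mem (hN : H.IsInduced C₁ C₂ N) (s : Sec H.glued) (y : G.Y) :
    TensorProduct.map (G.ρ₁ (G.i₁_mem y)) (LinearMap.id : B₂.Fib (G.f y) →ₗ[ℝ] B₂.Fib (G.f y))
      (N s (.inr (G.f y))) =
      TensorProduct.map LinearMap.id (H.map y).toLinearMap (C₁.toLin (H.fst s) y.1) := by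
  have h := congrArg (TensorProduct.map (LinearMap.fst ℝ (CotangentAt y.1) (CotangentAt (G.f y)))
    (LinearMap.id : B₂.Fib (G.f y) →ₗ[ℝ] B₂.Fib (G.f y))) (hN.both s y)
  simpa only [restrictBoth, inclSum, map_add, TensorProduct.map_map, LinearMap.fst_prod,
    LinearMap.fst_comp_inl, LinearMap.fst_comp_inr, LinearMap.id_comp, TensorProduct.map_zero_left,
    LinearMap.zero_apply, add_zero] using h

/-- The restriction of `∇^∪ s` to `X₂` is `∇²s₂`, inside and outside the domain of gluing. -/
theorem map_ρ₂ (hN : H.IsInduced C₁ C₂ N) (s : Sec H.glued) (x : X₂) :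
    TensorProduct.map (G.ρ₂ x) (LinearMap.id : B₂.Fib x →ₗ[ℝ] B₂.Fib x) (N s (.inr x)) =
      C₂.toLin (H.snd s) x := by
  by_cases hx : ∃ y, G.f y = x
  · obtain ⟨y, rfl⟩ := hx
    have h := congrArg (TensorProduct.map
      (LinearMap.snd ℝ (CotangentAt y.1) (CotangentAt (G.f y)))
      (LinearMap.id : B₂.Fib (G.f y) →ₗ[ℝ] B₂.Fib (G.f y))) (hN.both s y)
    simpa only [restrictBoth, inclSum, map_add, TensorProduct.map_map, LinearMap.snd_prod,
      LinearMap.snd_comp_inl, LinearMap.snd_comp_inr, LinearMap.id_comp,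
      TensorProduct.map_zero_left, LinearMap.zero_apply, zero_add, TensorProduct.map_id,
      LinearMap.id_apply] using h
  · exact hN.right s x fun y hy => hx ⟨y, hy⟩

variable {g₁ : ∀ x, LinearMap.BilinForm ℝ (B₁.Fib x)} {g₂ : ∀ x, LinearMap.BilinForm ℝ (B₂.Fib x)}

theorem inducedMetric_i₁ (hg : H.MetricsCompatible g₁ g₂) (s t : Sec H.glued) (x : X₁) :
    H.inducedMetric g₁ g₂ (G.i₁ x) (s (G.i₁ x)) (t (G.i₁ x)) =
      g₁ x (H.fst s x) (H.fst t x) := by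
  by_cases hx : x ∈ G.Y
  · rw [hg ⟨x, hx⟩, H.sectionsCompatible_fst_snd s ⟨x, hx⟩, H.sectionsCompatible_fst_snd t ⟨x, hx⟩,
      G.i₁_mem ⟨x, hx⟩]
    rfl
  · rw [H.fst_of_notMem s hx, H.fst_of_notMem t hx, G.i₁_notMem hx]
    rfl

theorem metricCompatible (hN : H.IsInduced C₁ C₂ N) (hg : H.MetricsCompatible g₁ g₂)
    (hCg₁ : MetricCompatible B₁ (fun s x => C₁.toLin s x) g₁)
    (hCg₂ : MetricCompatible B₂ (fun s x => C₂.toLin s x) g₂) :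
    MetricCompatible H.glued N (H.inducedMetric g₁ g₂) := by
  intro s t
  obtain ⟨h₁, hd₁⟩ := hCg₁ (H.fst s) (H.fst t)
  obtain ⟨h₂, hd₂⟩ := hCg₂ (H.snd s) (H.snd t)
  have hF₁ : (fun z => H.inducedMetric g₁ g₂ z (s z) (t z)) ∘ G.i₁ =
      fun x => g₁ x (H.fst s x) (H.fst t x) := funext (inducedMetric_i₁ hg s t)
  have hF : DSmooth fun z => H.inducedMetric g₁ g₂ z (s z) (t z) :=
    G.dSmooth_of_comp (by rwa [hF₁]) h₂
  have hdF : pullback G.i₁ G.smooth_i₁ (differential _ hF) = differential _ h₁ :=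
    Form.ext fun n p hp r => by
      change fderiv ℝ (((fun z => H.inducedMetric g₁ g₂ z (s z) (t z)) ∘ G.i₁) ∘ p) r = _
      rw [hF₁]
      rfl
  have hρ₁ : ∀ {x : X₁} {z : Glued G} (e : G.i₁ x = z),
      G.ρ₁ e (valueAt z (differential _ hF)) = valueAt x (differential _ h₁) :=
    fun {x} {z} e => congrArg (valueAt x) hdF
  refine ⟨hF, ?_⟩
  rintro (⟨x, hx⟩ | x)
  · refine G.cotangent_ext (fun x' e => ?_) (fun x' e => nomatch e)
    obtain rfl := G.i₁_injective (e.trans (G.i₁_notMem hx).symm)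
    rw [hρ₁, hd₁, map_add]
    dsimp only
    rw [← hN.left s x' hx, ← hN.left t x' hx]
    congr 1
    · exact contraction_map (G.ρ₁ e) LinearMap.id
        (fun v => by rw [H.fst_of_notMem t hx]; rfl) _
    · exact contraction_map (G.ρ₁ e) LinearMap.id
        (fun v => by rw [H.fst_of_notMem s hx]; rfl) _
  · refine G.cotangent_ext (fun x' e => ?_) (fun x' e => ?_)
    · obtain ⟨hx', rfl⟩ := G.i₁_eq_inr e
      rw [hρ₁, hd₁, map_add]
      have hs := H.sectionsCompatible_fst_snd s ⟨x', hx'⟩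
      have ht := H.sectionsCompatible_fst_snd t ⟨x', hx'⟩
      -- Both contractions are compared with the one of `(Id ⊗ f̃)(∇¹s₁(y))` by the metric of `V₂`.
      congr 1
      · refine ((contraction_map LinearMap.id (H.map ⟨x', hx'⟩).toLinearMap
          (l' := (g₂ (G.f ⟨x', hx'⟩)).flip (t (.inr (G.f ⟨x', hx'⟩)))) (fun v => ?_) _).symm.trans
          (congrArg _ (hN.map_ρ₁_of_mem s ⟨x', hx'⟩).symm)).trans
          (contraction_map (G.ρ₁ e) LinearMap.id (fun v => rfl) _)
        exact (congrArg _ ht.symm).trans (hg ⟨x', hx'⟩ _ _).symm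
      · refine ((contraction_map LinearMap.id (H.map ⟨x', hx'⟩).toLinearMap
          (l' := g₂ (G.f ⟨x', hx'⟩) (s (.inr (G.f ⟨x', hx'⟩)))) (fun v => ?_) _).symm.trans
          (congrArg _ (hN.map_ρ₁_of_mem t ⟨x', hx'⟩).symm)).trans
          (contraction_map (G.ρ₁ e) LinearMap.id (fun v => rfl) _)
        exact (congrArg (fun w => g₂ (G.f ⟨x', hx'⟩) w (H.map ⟨x', hx'⟩ v)) hs.symm).trans
          (hg ⟨x', hx'⟩ _ _).symm
    · obtain rfl := Glued.inr.inj e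
      refine (hd₂ x').trans (Eq.trans ?_ (map_add (G.ρ₂ x') _ _).symm)
      dsimp only
      rw [← hN.map_ρ₂ s x', ← hN.map_ρ₂ t x']
      congr 1
      · exact contraction_map (G.ρ₂ x') LinearMap.id (fun v => rfl) _
      · exact contraction_map (G.ρ₂ x') LinearMap.id (fun v => rfl) _

end IsInduced

end BundleGluing

end DiffGluing

theorem mainTheorem7 {X₁ : Type u₁} {X₂ : Type u₂}
    [DiffeologicalSpace X₁] [DiffeologicalSpace X₂] {G : DiffGluing.Gluing X₁ X₂}
    {B₁ : DiffGluing.PseudoBundle.{u₁, v} X₁} {B₂ : DiffGluing.PseudoBundle.{u₂, v} X₂}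
    (hfin₁ : ∀ x, FiniteDimensional ℝ (B₁.Fib x)) (hfin₂ : ∀ x, FiniteDimensional ℝ (B₂.Fib x))
    (H : DiffGluing.BundleGluing G B₁ B₂) (hD : G.D₁ = G.D₂)
    (g₁ : ∀ x, LinearMap.BilinForm ℝ (B₁.Fib x)) (hg₁ : DiffGluing.IsPseudoMetric B₁ g₁)
    (g₂ : ∀ x, LinearMap.BilinForm ℝ (B₂.Fib x)) (hg₂ : DiffGluing.IsPseudoMetric B₂ g₂)
    (C₁ : DiffGluing.Connection B₁) (C₂ : DiffGluing.Connection B₂)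
    (hCg₁ : DiffGluing.MetricCompatible B₁ (fun s x => C₁.toLin s x) g₁)
    (hCg₂ : DiffGluing.MetricCompatible B₂ (fun s x => C₂.toLin s x) g₂)
    (hg : H.MetricsCompatible g₁ g₂) (hC : H.ConnectionsCompatible C₁ C₂)
    (hwd : H.InducedWellDefined C₁ C₂) :
    H.IsInduced C₁ C₂ (H.inducedConnection C₁ C₂) ∧
      DiffGluing.MetricCompatible H.glued (H.inducedConnection C₁ C₂) (H.inducedMetric g₁ g₂) := by
  exact ⟨DiffGluing.BundleGluing.isInduced_inducedConnection hD hwd,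
    (DiffGluing.BundleGluing.isInduced_inducedConnection hD hwd).metricCompatible hg hCg₁ hCg₂⟩
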